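/- Let $n\ge 2$ and let $(\mathcal M,g)$ be a spacetime: a connected Hausdorff $C^\infty$ manifold of dimension $n$ (in particular $n=4$) with a $C^\infty$ Lorentzian metric $g$ of signature $(+,-,\dots,-)$ and a time-orientation (a choice of one timecone at each point which locally contains a smooth vector field). Geodesics are the solutions of $\ddot x^a+\Gamma^a_{bc}\dot x^b\dot x^c=0$ for the Levi-Civita connection, taken on compact parameter intervals $[a,b]$, $a<b$ (and being geodesics on an open interval containing $[a,b]$). A timelike (null) geodesic is one whose tangent vectors $v$ satisfy $g(v,v)>0$ (respectively $g(v,v)=0$ and $v\neq 0$). A null vector is future-pointing if it is a limit of future-pointing timelike vectors, and a geodesic *from* $x$ *to* $y$ is always future-pointing, with past endpoint $x$ and future endpoint $y$. Write $x\ll y$ if there is a trip from $x$ to $y$, i.e. a finite nonempty succession of future-pointing timelike geodesics leading from $x$ to $y$, each starting where the preceding one ends; write $x\prec y$ if there is a causal trip from $x$ to $y$, i.e. such a succession of future-pointing timelike or null geodesics, where degenerate (constant) geodesics are also allowed. **Proposition.** Let $x,y,z\in\mathcal M$. 1. If $x\ll y$ and $y\prec z$, then $x\ll z$; and if $x\prec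 y$ and $y\ll z$, then $x\ll z$. 2. If $\mu:[a,b]\to\mathcal M$ is a null geodesic from $x$ to $y$ and $\nu:[c,d]\to\mathcal M$ is a null geodesic from $y$ to $z$, then either $x\ll z$ or $\mu\cup\nu$ is a single null geodesic from $x$ to $z$, that is, for some $k>0$ there is a null geodesic $\rho:[a,b+k(d-c)]\to\mathcal M$ with $\rho(t)=\mu(t)$ for $t\in[a,b]$ and $\rho(b+k(s-c))=\nu(s)$ for $s\in[c,d]$. 3. If $x\prec y$, $x\not\ll y$ and $x\neq y$, then there is a null geodesic from $x$ to $y$. -/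

import Mathlib

open Set Filter Topology
open scoped Manifold ContDiff

noncomputable section

/-- A smooth Lorentz metric, of signature `(+, -, …, -)`, on an `n`-dimensional manifold `M`. -/
structure LorentzMetric (n : ℕ) (M : Type*) [TopologicalSpace M]
    [ChartedSpace (EuclideanSpace ℝ (Fin n)) M] [IsManifold (𝓡 n) ∞ M] where
  /-- The scalar product on each tangent space. -/
  val : ∀ x : M, TangentSpace (𝓡 n) x →L[ℝ] TangentSpace (𝓡 n) x →L[ℝ] ℝ
  symm : ∀ (x : M) (v w : TangentSpace (𝓡 n) x), val x v w = val x w v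
  smooth : ContMDiff (𝓡 n)
    ((𝓡 n).prod 𝓘(ℝ, EuclideanSpace ℝ (Fin n) →L[ℝ] EuclideanSpace ℝ (Fin n) →L[ℝ] ℝ)) ∞
    (fun x ↦ Bundle.TotalSpace.mk'
      (EuclideanSpace ℝ (Fin n) →L[ℝ] EuclideanSpace ℝ (Fin n) →L[ℝ] ℝ)
      (E := fun x : M ↦ TangentSpace (𝓡 n) x →L[ℝ] TangentSpace (𝓡 n) x →L[ℝ] ℝ) x (val x))
  /-- At every point the matrix of the metric is `diag (1, -1, …, -1)` in a suitable basis. -/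
  lorentzian : ∀ x : M, ∃ b : Module.Basis (Fin n) ℝ (TangentSpace (𝓡 n) x),
    ∀ i j : Fin n, val x (b i) (b j) = if i = j then (if i.val = 0 then 1 else -1) else 0

namespace LorentzMetric

variable {n : ℕ} {M : Type*} [TopologicalSpace M]
  [ChartedSpace (EuclideanSpace ℝ (Fin n)) M] [IsManifold (𝓡 n) ∞ M]

/-- `v` is timelike: `g(v, v) > 0`. -/
def IsTimelike (g : LorentzMetric n M) {x : M} (v : TangentSpace (𝓡 n) x) : Prop :=
  0 < g.val x v v

/-- `v` is null: `g(v, v) = 0` and `v ≠ 0`. -/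
def IsNull (g : LorentzMetric n M) {x : M} (v : TangentSpace (𝓡 n) x) : Prop :=
  g.val x v v = 0 ∧ v ≠ 0

/-- The timecone of a vector `u` at `x`: the timelike vectors `v` with `g(u, v) > 0`. -/
def timecone (g : LorentzMetric n M) {x : M} (u : TangentSpace (𝓡 n) x) :
    Set (TangentSpace (𝓡 n) x) :=
  {v | g.IsTimelike v ∧ 0 < g.val x u v}

/-- The components of the metric in the chart `e`: the value at `u` is the bilinear form
`(v, w) ↦ g_{ab}(u) v^a w^b`, that is, the pull-back of `g` under `e⁻¹`. -/
def inChart (g : LorentzMetric n M) (e : OpenPartialHomeomorph M (EuclideanSpace ℝ (Fin n)))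
    (u : EuclideanSpace ℝ (Fin n)) :
    EuclideanSpace ℝ (Fin n) →L[ℝ] EuclideanSpace ℝ (Fin n) →L[ℝ] ℝ :=
  let B : EuclideanSpace ℝ (Fin n) →L[ℝ] EuclideanSpace ℝ (Fin n) →L[ℝ] ℝ := g.val (e.symm u)
  let D : EuclideanSpace ℝ (Fin n) →L[ℝ] EuclideanSpace ℝ (Fin n) :=
    mfderiv 𝓘(ℝ, EuclideanSpace ℝ (Fin n)) (𝓡 n) e.symm u
  B.bilinearComp D D

/-- Christoffel symbols of the first kind of the Levi-Civita connection, in the chart `e`: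
the covector `z ↦ (1/2) (∂_v g(w, z) + ∂_w g(v, z) - ∂_z g(v, w))`. -/
def christoffelLower (g : LorentzMetric n M)
    (e : OpenPartialHomeomorph M (EuclideanSpace ℝ (Fin n)))
    (u v w : EuclideanSpace ℝ (Fin n)) : EuclideanSpace ℝ (Fin n) →L[ℝ] ℝ :=
  (1 / 2 : ℝ) • (fderiv ℝ (g.inChart e) u v w + fderiv ℝ (g.inChart e) u w v
    - ((fderiv ℝ (g.inChart e) u).flip v).flip w)

/-- Christoffel symbols of the Levi-Civita connection, in the chart `e`: the vector
`Γ^a_{bc} v^b w^c`, where `Γ^a_{bc} = (1/2) g^{ad} (∂_b g_{dc} + ∂_c g_{db} - ∂_d g_{bc})`. -/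
def christoffel (g : LorentzMetric n M)
    (e : OpenPartialHomeomorph M (EuclideanSpace ℝ (Fin n)))
    (u v w : EuclideanSpace ℝ (Fin n)) : EuclideanSpace ℝ (Fin n) :=
  (g.inChart e u).inverse (g.christoffelLower e u v w)

end LorentzMetric

/-- The tangent vector `γ' (t)` of a path `γ`. -/
def velocity (n : ℕ) {M : Type*} [TopologicalSpace M]
    [ChartedSpace (EuclideanSpace ℝ (Fin n)) M] (γ : ℝ → M) (t : ℝ) :
    TangentSpace (𝓡 n) (γ t) :=
  mfderiv 𝓘(ℝ, ℝ) (𝓡 n) γ t (1 : ℝ)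

/-- A time-orientation: a choice of one of the two timecones at each point, such that every point
has a neighbourhood with a smooth vector field taking values in the chosen cones. -/
structure TimeOrientation {n : ℕ} {M : Type*} [TopologicalSpace M]
    [ChartedSpace (EuclideanSpace ℝ (Fin n)) M] [IsManifold (𝓡 n) ∞ M]
    (g : LorentzMetric n M) where
  /-- The timecone of future-pointing timelike vectors at each point. -/
  cone : ∀ x : M, Set (TangentSpace (𝓡 n) x)
  isTimecone : ∀ x : M, ∃ u : TangentSpace (𝓡 n) x, g.IsTimelike u ∧ cone x = g.timecone u
  smooth : ∀ x : M, ∃ U : Set M, IsOpen U ∧ x ∈ U ∧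
    ∃ X : ∀ y : M, TangentSpace (𝓡 n) y,
      ContMDiffOn (𝓡 n) (𝓡 n).tangent ∞
        (fun y ↦ (⟨y, X y⟩ : TangentBundle (𝓡 n) M)) U ∧
      ∀ y ∈ U, X y ∈ cone y

section Causality

variable {n : ℕ} {M : Type*} [TopologicalSpace M]
  [ChartedSpace (EuclideanSpace ℝ (Fin n)) M] [IsManifold (𝓡 n) ∞ M]

/-- `γ` is smooth on the open set `J` and satisfies there the geodesic equation
`ẍ^a + Γ^a_{bc} ẋ^b ẋ^c = 0` in every smooth chart. Constant paths are allowed. -/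
def IsGeodesicOn (g : LorentzMetric n M) (γ : ℝ → M) (J : Set ℝ) : Prop :=
  ContMDiffOn 𝓘(ℝ, ℝ) (𝓡 n) ∞ γ J ∧
  ∀ t ∈ J, ∀ e ∈ IsManifold.maximalAtlas (𝓡 n) ∞ M, γ t ∈ e.source →
    deriv (deriv (e ∘ γ)) t
      + g.christoffel e (e (γ t)) (deriv (e ∘ γ) t) (deriv (e ∘ γ) t) = 0

/-- `γ` restricted to `[a, b]`, `a < b`, is a geodesic segment: it is a geodesic on an open
interval containing `[a, b]`. -/
def IsGeodesicSegment (g : LorentzMetric n M) (γ : ℝ → M) (a b : ℝ) : Prop :=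
  a < b ∧ ∃ a' b' : ℝ, a' < a ∧ b < b' ∧ IsGeodesicOn g γ (Ioo a' b')

variable {g : LorentzMetric n M}

/-- A future-pointing timelike vector. -/
def TimeOrientation.IsFutureTimelike (τ : TimeOrientation g) {x : M}
    (v : TangentSpace (𝓡 n) x) : Prop :=
  v ∈ τ.cone x

/-- A future-pointing null vector: a null vector which is a limit of future-pointing timelike
vectors. -/
def TimeOrientation.IsFutureNull (τ : TimeOrientation g) {x : M}
    (v : TangentSpace (𝓡 n) x) : Prop :=
  g.IsNull v ∧ v ∈ closure (τ.cone x)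

/-- `γ` on `[a, b]` is a future-pointing timelike geodesic. -/
def TimeOrientation.IsTimelikeGeodesic (τ : TimeOrientation g) (γ : ℝ → M) (a b : ℝ) : Prop :=
  IsGeodesicSegment g γ a b ∧ ∀ t ∈ Icc a b, τ.IsFutureTimelike (velocity n γ t)

/-- `γ` on `[a, b]` is a future-pointing null geodesic (nondegenerate, as null vectors are
nonzero). -/
def TimeOrientation.IsNullGeodesic (τ : TimeOrientation g) (γ : ℝ → M) (a b : ℝ) : Prop :=
  IsGeodesicSegment g γ a b ∧ ∀ t ∈ Icc a b, τ.IsFutureNull (velocity n γ t)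

/-- `γ` on `[a, b]` is a degenerate (constant) geodesic. -/
def IsDegenerateGeodesic (g : LorentzMetric n M) (γ : ℝ → M) (a b : ℝ) : Prop :=
  IsGeodesicSegment g γ a b ∧ ∀ t ∈ Icc a b, velocity n γ t = 0

/-- `γ` on `[a, b]` is a future-pointing causal geodesic, possibly degenerate. -/
def TimeOrientation.IsCausalGeodesic (τ : TimeOrientation g) (γ : ℝ → M) (a b : ℝ) : Prop :=
  τ.IsTimelikeGeodesic γ a b ∨ τ.IsNullGeodesic γ a b ∨ IsDegenerateGeodesic g γ a b

/-- `x ≪ y`: there is a trip from `x` to `y`, that is, a finite nonempty succession of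
future-pointing timelike geodesics, the first starting at `x`, the last ending at `y`, and each
starting where the preceding one ends. -/
def TimeOrientation.Chron (τ : TimeOrientation g) : M → M → Prop :=
  Relation.TransGen fun p q ↦
    ∃ (γ : ℝ → M) (a b : ℝ), τ.IsTimelikeGeodesic γ a b ∧ γ a = p ∧ γ b = q

/-- `x ≺ y`: there is a causal trip from `x` to `y`, that is, a finite nonempty succession of
future-pointing causal geodesics, possibly degenerate, the first starting at `x`, the last ending
at `y`, and each starting where the preceding one ends. -/
def TimeOrientation.Causal (τ : TimeOrientation g) : M → M → Prop :=
  Relation.TransGen fun p q ↦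
    ∃ (γ : ℝ → M) (a b : ℝ), τ.IsCausalGeodesic γ a b ∧ γ a = p ∧ γ b = q

end Causality

end

/-! Everything rests on one local fact and on the openness of the timecones. The local fact is
`eventually_chron`: in a chart, if `w` is close to a future timelike vector at a point near `u` and
`h > 0` is small, then `u` and `u + h w` are joined by a future timelike geodesic. The two-point
boundary value problem for the geodesic equation is solved by a contraction, and the velocity of the
solution stays close to `w`. Hence curves with future timelike velocity have chronologically related
end points, and chronological futures and pasts are open.

A null geodesic `γ` is handled by tilting it, in a chart, to `γ t + ε (t - t₁) U` with `U` future
timelike. The tilt adds at least `2 ε g(U, γ')` to the square of the velocity, while the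
displacement changes the metric by only `O(ε · length)`; on a short piece the tilted curve is
therefore timelike for every `ε` in `(0, 1]`. It still passes through `γ t₁`, and its other end
moves by `O(ε)`, so openness carries `≪` along `γ` (`IsNullGeodesic.push`). This is the first claim.

At a corner the two tangent vectors `k`, `l` are null and in the same half-cone. Either `g(k, l) >
0`, so `k + l` is timelike and approximates the direction of the short chords cutting the corner, or
`l` is a positive multiple of `k`, and uniqueness of geodesics glues the two pieces after an affine
change of parameter. The third claim follows by induction along the causal trip. -/

noncomputable section

/-! ### Linear algebra of Lorentzian forms -/

/-- A symmetric bilinear form of signature `(+, -, …, -)`: some vector is timelike, and the form is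
negative definite on the orthogonal complement of each timelike vector. -/
structure IsLorentzForm {E : Type*} [NormedAddCommGroup E] [NormedSpace ℝ E]
    (B : E →L[ℝ] E →L[ℝ] ℝ) : Prop where
  symm : ∀ v w, B v w = B w v
  exists_pos : ∃ u, 0 < B u u
  neg_of_orthogonal : ∀ u w, 0 < B u u → B u w = 0 → w ≠ 0 → B w w < 0

namespace IsLorentzForm

variable {E : Type*} [NormedAddCommGroup E] [NormedSpace ℝ E] {B : E →L[ℝ] E →L[ℝ] ℝ}

lemma nonpos_of_orthogonal (hB : IsLorentzForm B) {u w : E} (hu : 0 < B u u) (h : B u w = 0) :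
    B w w ≤ 0 := by
  by_cases hw : w = 0
  · simp [hw]
  · exact (hB.neg_of_orthogonal u w hu h hw).le

/-- The combination `B u w • v - B u v • w` is orthogonal to `u`, so its square is nonpositive;
expanding gives a positive lower bound for `2 * B u v * B u w * B v w`. -/
lemma pos_of_same_cone (hB : IsLorentzForm B) {u v w : E} (hu : 0 < B u u) (hv : 0 < B v v)
    (hw : 0 < B w w) (huv : 0 < B u v) (huw : 0 < B u w) : 0 < B v w := by
  have h := hB.nonpos_of_orthogonal (w := B u w • v - B u v • w) hu (by simp; ring)
  simp only [map_sub, map_smul, _root_.sub_apply, _root_.smul_apply,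
    smul_eq_mul, hB.symm w v] at h
  by_contra! hvw
  have h1 : 0 < B u w * B u w * B v v := by positivity
  have h2 : 0 < B u v * B u v * B w w := by positivity
  nlinarith [mul_nonneg (mul_pos huv huw).le (neg_nonneg.2 hvw)]

lemma cone_eq (hB : IsLorentzForm B) {u v : E} (hu : 0 < B u u) (hv : 0 < B v v)
    (huv : 0 < B u v) (w : E) : (0 < B w w ∧ 0 < B u w) ↔ (0 < B w w ∧ 0 < B v w) :=
  ⟨fun h ↦ ⟨h.1, hB.pos_of_same_cone hu hv h.1 huv h.2⟩,
    fun h ↦ ⟨h.1, hB.pos_of_same_cone hv hu h.1 (by rwa [hB.symm]) h.2⟩⟩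

lemma ne_zero_of_null (hB : IsLorentzForm B) {u k : E} (hu : 0 < B u u) (hk : B k k = 0)
    (hk0 : k ≠ 0) : B u k ≠ 0 := fun h ↦
  (hB.neg_of_orthogonal u k hu h hk0).ne hk

lemma eq_zero_of_forall (hB : IsLorentzForm B) {w : E} (h : ∀ z, B w z = 0) : w = 0 := by
  obtain ⟨u, hu⟩ := hB.exists_pos
  by_contra hw
  exact hB.ne_zero_of_null hu (h w) hw (by rw [hB.symm, h])

/-- The same orthogonal combination as in `pos_of_same_cone`; only the cross term survives, because
`k` and `l` are null. -/
lemma null_mul_nonneg (hB : IsLorentzForm B) {u k l : E} (hu : 0 < B u u) (hk : B k k = 0)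
    (hl : B l l = 0) (huk : 0 < B u k) (hul : 0 < B u l) : 0 ≤ B k l := by
  have h := hB.nonpos_of_orthogonal (w := B u l • k - B u k • l) hu (by simp; ring)
  simp only [map_sub, map_smul, _root_.sub_apply, _root_.smul_apply,
    smul_eq_mul, hB.symm l k, hk, hl] at h
  by_contra! hkl
  nlinarith [mul_pos (mul_pos huk hul) (neg_pos.2 hkl)]

/-- Two null vectors in the same half-cone have a timelike sum, unless they are proportional. -/
lemma add_timelike_or_proportional (hB : IsLorentzForm B) {u k l : E} (hu : 0 < B u u)
    (hk : B k k = 0) (hl : B l l = 0) (huk : 0 < B u k) (hul : 0 < B u l) :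
    (0 < B (k + l) (k + l)) ∨ ∃ c : ℝ, 0 < c ∧ l = c • k := by
  rcases (hB.null_mul_nonneg hu hk hl huk hul).lt_or_eq with h | h
  · left
    simp only [map_add, _root_.add_apply, hk, hl, hB.symm l k]
    linarith
  · right
    refine ⟨B u l / B u k, by positivity, ?_⟩
    have h0 : B u l • k - B u k • l = 0 := by
      by_contra hne
      have := hB.neg_of_orthogonal u _ hu (by simp; ring) hne
      simp only [map_sub, map_smul, _root_.sub_apply, _root_.smul_apply,
        smul_eq_mul, hB.symm l k, hk, hl, ← h] at this
      linarith
    rw [div_eq_inv_mul, mul_smul, sub_eq_zero.1 h0, smul_smul, inv_mul_cancel₀ huk.ne', one_smul]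

lemma isInvertible [FiniteDimensional ℝ E] (hB : IsLorentzForm B) : B.IsInvertible := by
  have hinj : Function.Injective B.toLinearMap := by
    rw [← LinearMap.ker_eq_bot, LinearMap.ker_eq_bot']
    intro w hw
    exact hB.eq_zero_of_forall fun z ↦ by
      have : B w = 0 := hw
      simp [this]
  have hdim : Module.finrank ℝ E = Module.finrank ℝ (E →L[ℝ] ℝ) := by
    rw [← (LinearMap.toContinuousLinearMap (𝕜 := ℝ) (E := E) (F' := ℝ)).finrank_eq]
    exact Subspace.dual_finrank_eq.symm
  refine ⟨(LinearEquiv.ofInjectiveOfFinrankEq B.toLinearMap hinj hdim).toContinuousLinearEquiv, ?_⟩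
  ext v w
  rfl

lemma comp (hB : IsLorentzForm B) (D : E →L[ℝ] E) (hinj : Function.Injective D)
    (hsurj : Function.Surjective D) : IsLorentzForm (B.bilinearComp D D) where
  symm v w := by simp [hB.symm (D v)]
  exists_pos := by
    obtain ⟨u, hu⟩ := hB.exists_pos
    obtain ⟨v, rfl⟩ := hsurj u
    exact ⟨v, hu⟩
  neg_of_orthogonal u w hu h hw := hB.neg_of_orthogonal (D u) (D w) hu h
    fun h0 ↦ hw (hinj (h0.trans D.map_zero.symm))

/-- A form with matrix `diag (1, -1, …, -1)` is Lorentzian. -/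
lemma of_basis {m : ℕ} (b : Module.Basis (Fin (m + 1)) ℝ E)
    (hb : ∀ i j : Fin (m + 1), B (b i) (b j) = if i = j then (if i.val = 0 then 1 else -1) else 0) :
    IsLorentzForm B := by
  have key : ∀ v w, B v w = b.repr v 0 * b.repr w 0
      - ∑ i : Fin m, b.repr v i.succ * b.repr w i.succ := by
    intro v w
    conv_lhs => rw [← b.sum_repr v, ← b.sum_repr w]
    simp only [map_sum, map_smul, _root_.sum_apply, _root_.smul_apply,
      hb, smul_eq_mul, mul_ite, mul_zero, Finset.sum_ite_eq', Finset.mem_univ,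
      if_true]
    rw [Fin.sum_univ_succ]
    simp [Finset.sum_neg_distrib, sub_eq_add_neg, mul_comm]
  refine ⟨fun v w ↦ ?_, ⟨b 0, by simp [hb]⟩, fun u w hu h hw ↦ ?_⟩
  · simp only [key, mul_comm]
  · rw [key] at hu h ⊢
    -- Orthogonality turns Cauchy–Schwarz on the spatial components into `(u₀ w₀)² ≤ S T`. Since
    -- `u₀² > S`, this forces `w₀² < T` when `T > 0`, and `w = 0` when `T = 0`.
    have hcs := Finset.sum_mul_sq_le_sq_mul_sq Finset.univ
      (fun i : Fin m ↦ b.repr u i.succ) (fun i : Fin m ↦ b.repr w i.succ)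
    simp only [← sq] at hu ⊢
    rw [← sub_eq_zero.1 h] at hcs
    set S := ∑ i : Fin m, b.repr u i.succ ^ 2
    set T := ∑ i : Fin m, b.repr w i.succ ^ 2 with hT
    have hS0 : 0 ≤ S := Finset.sum_nonneg fun _ _ ↦ sq_nonneg _
    have hT0 : 0 ≤ T := Finset.sum_nonneg fun _ _ ↦ sq_nonneg _
    have hu0 : 0 < b.repr u 0 ^ 2 := by linarith
    rcases hT0.lt_or_eq with hpos | hzero
    · by_contra! hcon
      nlinarith [mul_pos (sub_pos.2 (sub_pos.1 hu)) hpos]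
    · exfalso
      rw [← hzero, mul_zero, mul_pow] at hcs
      have hw0 : b.repr w 0 = 0 := by
        by_contra hne
        have : 0 < b.repr w 0 ^ 2 := by positivity
        nlinarith [mul_pos hu0 this]
      have hall := (Finset.sum_eq_zero_iff_of_nonneg fun _ _ ↦ sq_nonneg _).1 (hT ▸ hzero.symm)
      refine hw (b.repr.map_eq_zero_iff.1 ?_)
      ext i
      refine Fin.cases hw0 (fun j ↦ ?_) i
      simpa using hall j (Finset.mem_univ j)

end IsLorentzForm
end

/-! ### Second order equations: boundary values, smoothness, uniqueness -/

noncomputable section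

section BoundaryValue

open BoundedContinuousFunction intervalIntegral

variable {E : Type*} [NormedAddCommGroup E] [NormedSpace ℝ E] [CompleteSpace E]

/-- The boundary value problem `x'' = H (x, x')`, `x 0 = u`, `x h = u + h w` has a solution on
`(-h, 2h)` if `H` is bounded and Lipschitz and `h` is small. -/
theorem exists_boundary_value_solution {H : E × E → E} {K : NNReal} (hK : LipschitzWith K H)
    {B : ℝ} (hB : ∀ p, ‖H p‖ ≤ B) {h : ℝ} (h0 : 0 < h) (h1 : 2 * h ≤ 1) (h2 : 4 * h * K < 1)
    (u w : E) :
    ∃ x q : ℝ → E, x 0 = u ∧ x h = u + h • w ∧ ∀ t ∈ Ioo (-h) (2 * h),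
      HasDerivAt x (q t) t ∧ HasDerivAt q (H (x t, q t)) t ∧
      ‖q t - w‖ ≤ 4 * h * B ∧ ‖x t - u‖ ≤ 2 * h * (‖w‖ + 4 * h * B) := by
  have hB0 : 0 ≤ B := (norm_nonneg _).trans (hB 0)
  let X : (ℝ →ᵇ E) → ℝ → E := fun q t ↦ u + ∫ s in (0 : ℝ)..t, q s
  have hXc : ∀ q, Continuous (X q) := fun q ↦
    continuous_const.add (continuous_primitive (fun _ _ ↦ q.continuous.intervalIntegrable _ _) 0)
  let A : (ℝ →ᵇ E) → ℝ → E := fun q t ↦ ∫ s in (0 : ℝ)..t, H (X q s, q s)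
  have hHc : ∀ q : ℝ →ᵇ E, Continuous fun s ↦ H (X q s, q s) := fun q ↦
    hK.continuous.comp ((hXc q).prodMk q.continuous)
  have hAc : ∀ q, Continuous (A q) := fun q ↦
    continuous_primitive (fun _ _ ↦ (hHc q).intervalIntegrable _ _) 0
  -- The unknown of the fixed point problem is the velocity `q`. Freezing time outside `[-h, 2h]`
  -- keeps the iterates bounded on all of `ℝ`.
  let clip : ℝ → ℝ := fun t ↦ max (-h) (min t (2 * h))
  have hclip : Continuous clip := by fun_prop
  have hclip_le : ∀ t, |clip t| ≤ 2 * h := fun t ↦ by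
    rw [abs_le]
    exact ⟨le_trans (by linarith) (le_max_left _ _), max_le (by linarith) (min_le_right _ _)⟩
  have hclip_eq : ∀ t ∈ Icc (-h) (2 * h), clip t = t := fun t ht ↦ by
    simp only [clip]
    rw [min_eq_left ht.2, max_eq_right ht.1]
  -- Subtracting the mean of `A q` over `[0, h]` forces the fixed point to have mean velocity `w`
  -- there, which is the boundary condition at `h`.
  let avg : (ℝ →ᵇ E) → E := fun q ↦ h⁻¹ • ∫ s in (0 : ℝ)..h, A q s
  have hAb : ∀ q t, |t| ≤ 2 * h → ‖A q t‖ ≤ 2 * h * B := fun q t ht ↦ by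
    have := norm_integral_le_of_norm_le_const (a := 0) (b := t) (C := B)
      (f := fun s ↦ H (X q s, q s)) fun _ _ ↦ hB _
    rw [sub_zero] at this
    nlinarith
  have avg_le : ∀ (f : ℝ → E) (C : ℝ), (∀ s ∈ Ioc 0 h, ‖f s‖ ≤ C) →
      ‖h⁻¹ • ∫ s in (0 : ℝ)..h, f s‖ ≤ C := fun f C hf ↦ by
    have := norm_integral_le_of_norm_le_const (a := 0) (b := h) (C := C) (f := f)
      (by rwa [uIoc_of_le h0.le])
    rw [sub_zero, abs_of_pos h0] at this
    rw [norm_smul, norm_inv, Real.norm_of_nonneg h0.le, inv_mul_le_iff₀ h0]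
    linarith
  have habs : ∀ s ∈ Ioc 0 h, |s| ≤ 2 * h := fun s hs ↦ by
    rw [abs_of_pos hs.1]
    linarith [hs.2]
  have hTb : ∀ q t, ‖(A q (clip t) - avg q)‖ ≤ 4 * h * B := fun q t ↦ by
    have := norm_sub_le (A q (clip t)) (avg q)
    have := hAb q _ (hclip_le t)
    have := avg_le (A q) (2 * h * B) fun s hs ↦ hAb q s (habs s hs)
    linarith
  let T : (ℝ →ᵇ E) → (ℝ →ᵇ E) := fun q ↦
    ofNormedAddCommGroup (fun t ↦ w + (A q (clip t) - avg q))
      (continuous_const.add (((hAc q).comp hclip).sub continuous_const)) (‖w‖ + 4 * h * B)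
      fun t ↦ (norm_add_le _ _).trans (by linarith [hTb q t])
  have hT : ∀ q t, T q t = w + (A q (clip t) - avg q) := fun _ _ ↦ rfl
  have hAd : ∀ q q' t, |t| ≤ 2 * h → ‖A q t - A q' t‖ ≤ 2 * h * K * dist q q' := fun q q' t ht ↦ by
    simp only [A]
    rw [← integral_sub ((hHc q).intervalIntegrable _ _) ((hHc q').intervalIntegrable _ _)]
    have := norm_integral_le_of_norm_le_const (a := 0) (b := t) (C := K * dist q q')
      (f := fun s ↦ H (X q s, q s) - H (X q' s, q' s)) fun s hs ↦ by
        rw [← dist_eq_norm]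
        refine (hK.dist_le_mul _ _).trans (mul_le_mul_of_nonneg_left ?_ K.2)
        refine max_le ?_ (dist_coe_le_dist _)
        rw [dist_eq_norm]
        simp only [X, add_sub_add_left_eq_sub]
        rw [← integral_sub (q.continuous.intervalIntegrable _ _)
          (q'.continuous.intervalIntegrable _ _)]
        have h3 := norm_integral_le_of_norm_le_const (a := 0) (b := s) (C := dist q q')
          (f := fun s ↦ q s - q' s) fun r _ ↦ by
            rw [← dist_eq_norm]; exact dist_coe_le_dist _
        have hst : |s| ≤ |t| := by
          rcases mem_uIoc.1 hs with h | h
          · rw [abs_of_pos h.1]; exact h.2.trans (le_abs_self _)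
          · rw [abs_of_nonpos h.2, abs_of_nonpos (h.1.le.trans h.2)]; linarith
        rw [sub_zero] at h3
        -- Here `2 * h ≤ 1` gives `|s| ≤ 1`: positions differ by no more than the velocities do, so
        -- the maximum norm on `E × E` is controlled by `dist q q'`.
        have : dist q q' * |s| ≤ dist q q' * 1 :=
          mul_le_mul_of_nonneg_left (by linarith) dist_nonneg
        linarith
    rw [sub_zero] at this
    have h4 : K * dist q q' * |t| ≤ K * dist q q' * (2 * h) :=
      mul_le_mul_of_nonneg_left ht (mul_nonneg K.2 dist_nonneg)
    linarith
  -- The constant is `2 * h * K` from `A` plus `2 * h * K` from its mean.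
  have hTd : ContractingWith ⟨4 * h * K, mul_nonneg (by positivity) K.2⟩ T := by
    refine ⟨by exact_mod_cast h2, LipschitzWith.of_dist_le_mul fun q q' ↦ ?_⟩
    refine (dist_le (mul_nonneg (NNReal.coe_nonneg _) dist_nonneg)).2 fun t ↦ ?_
    rw [hT, hT, dist_add_left, dist_eq_norm]
    have e1 := hAd q q' _ (hclip_le t)
    have e2 := avg_le (fun s ↦ A q s - A q' s) (2 * h * K * dist q q') fun s hs ↦
      hAd q q' s (habs s hs)
    rw [integral_sub ((hAc q).intervalIntegrable _ _) ((hAc q').intervalIntegrable _ _),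
      smul_sub] at e2
    have e3 := norm_sub_le (A q (clip t) - A q' (clip t)) (avg q - avg q')
    rw [show A q (clip t) - avg q - (A q' (clip t) - avg q')
      = (A q (clip t) - A q' (clip t)) - (avg q - avg q') by abel]
    change _ ≤ 4 * h * K * dist q q'
    linarith
  set q := hTd.fixedPoint T with hq
  have hfix : ∀ t, q t = w + (A q (clip t) - avg q) := fun t ↦ by
    rw [← hT, hq, (hTd.fixedPoint_isFixedPt)]
  have hqw : ∀ t, ‖q t - w‖ ≤ 4 * h * B := fun t ↦ by
    rw [hfix t, add_sub_cancel_left]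
    exact hTb q t
  refine ⟨X q, q, by simp [X], ?_, fun t ht ↦ ⟨?_, ?_, hqw t, ?_⟩⟩
  · have : ∫ s in (0 : ℝ)..h, q s = ∫ s in (0 : ℝ)..h, ((w - avg q) + A q s) := by
      refine integral_congr fun s hs ↦ ?_
      rw [uIcc_of_le h0.le] at hs
      rw [hfix s, hclip_eq s ⟨by linarith [hs.1], by linarith [hs.2]⟩]
      abel
    simp only [X, this]
    rw [integral_add (by simp) ((hAc q).intervalIntegrable _ _), integral_const, sub_zero, smul_sub]
    simp only [avg]
    rw [smul_inv_smul₀ h0.ne']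
    abel
  · exact ((q.continuous.integral_hasStrictDerivAt 0 t).hasDerivAt).const_add u
  · have hd : HasDerivAt (fun t ↦ w + (A q t - avg q)) (H (X q t, q t)) t :=
      ((((hHc q).integral_hasStrictDerivAt 0 t).hasDerivAt).sub_const _).const_add w
    refine hd.congr_of_eventuallyEq ?_
    filter_upwards [Ioo_mem_nhds ht.1 ht.2] with s hs
    rw [hfix s, hclip_eq s (Ioo_subset_Icc_self hs)]
  · simp only [X, add_sub_cancel_left]
    have := norm_integral_le_of_norm_le_const (a := 0) (b := t) (C := ‖w‖ + 4 * h * B)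
      (f := q) fun s _ ↦ by
        have := norm_add_le w (q s - w)
        rw [add_sub_cancel] at this
        linarith [hqw s]
    have ht' : |t| ≤ 2 * h := abs_le.2 ⟨by linarith [ht.1], ht.2.le⟩
    rw [sub_zero] at this
    have : (‖w‖ + 4 * h * B) * |t| ≤ (‖w‖ + 4 * h * B) * (2 * h) :=
      mul_le_mul_of_nonneg_left ht' (by positivity)
    linarith

end BoundaryValue

section SecondOrder

variable {E : Type*} [NormedAddCommGroup E] [NormedSpace ℝ E]

/-- Near a point and a velocity, two points are joined by a solution of a smooth second order
equation with nearly the given velocity. -/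
theorem eventually_exists_second_order_solution [FiniteDimensional ℝ E] {F : E × E → E}
    {p : E × E} (hF : ∀ᶠ z in 𝓝 p, ContDiffAt ℝ ∞ F z) {N : Set (E × E)} (hN : N ∈ 𝓝 p) :
    ∀ᶠ z : (E × E) × ℝ in 𝓝 p ×ˢ 𝓝[>] 0, ∃ x q : ℝ → E, x 0 = z.1.1 ∧
      x z.2 = z.1.1 + z.2 • z.1.2 ∧ ∀ t ∈ Ioo (-z.2) (2 * z.2),
        HasDerivAt x (q t) t ∧ HasDerivAt q (F (x t, q t)) t ∧ (x t, q t) ∈ N := by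
  have : CompleteSpace E := FiniteDimensional.complete ℝ E
  obtain ⟨ρ, hρ, hFρ⟩ := Metric.eventually_nhds_iff_ball.1 hF
  -- Cutting `F` off makes it bounded and globally Lipschitz; solutions that stay where `χ = 1` also
  -- solve the original equation.
  let χ : ContDiffBump p := ⟨ρ / 4, ρ / 2, by positivity, by linarith⟩
  let H : E × E → E := fun z ↦ χ z • F z
  have hHd : ContDiff ℝ ∞ H := contDiff_iff_contDiffAt.2 fun z ↦ by
    by_cases hz : z ∈ Metric.ball p ρ
    · exact (χ.contDiff (n := ⊤)).contDiffAt.smul (hFρ z hz)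
    · have hz' : z ∉ tsupport χ := fun h ↦ by
        rw [χ.tsupport_eq, Metric.mem_closedBall] at h
        have h' : dist z p ≤ ρ / 2 := h
        exact hz (Metric.mem_ball.2 (by linarith))
      refine (contDiffAt_const (c := (0 : E))).congr_of_eventuallyEq ?_
      filter_upwards [notMem_tsupport_iff_eventuallyEq.1 hz'] with y hy
      simp [H, hy]
  have hHc : HasCompactSupport H := χ.hasCompactSupport.smul_right
  obtain ⟨K, hK⟩ := hHd.lipschitzWith_of_hasCompactSupport hHc (by simp)
  obtain ⟨B, hB⟩ := hHc.exists_bound_of_continuous hHd.continuous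
  obtain ⟨ε, hε, hN'⟩ := Metric.mem_nhds_iff.1 (inter_mem hN χ.eventuallyEq_one)
  -- The first two bounds are the hypotheses of the boundary value theorem. The last two keep the
  -- velocity within `ε / 2` of `w` and the position within `ε / 2` of `u`, hence the solution in
  -- the `ε`-ball around `p`.
  have hh : ∀ᶠ h : ℝ in 𝓝 0, 2 * h < 1 ∧ 4 * h * K < 1 ∧ 4 * h * B < ε / 2 ∧
      2 * h * (‖p.2‖ + ε / 2 + 4 * h * B) < ε / 2 := by
    have lt (f : ℝ → ℝ) (hf : Continuous f) (c : ℝ) (hc : f 0 < c) : ∀ᶠ h : ℝ in 𝓝 0, f h < c :=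
      hf.continuousAt.eventually_lt continuousAt_const hc
    refine (lt _ (by fun_prop) _ (by simp)).and ((lt _ (by fun_prop) _ (by simp)).and
      ((lt _ (by fun_prop) _ (by simp [hε])).and (lt _ (by fun_prop) _ (by simp [hε]))))
  filter_upwards [prod_mem_prod (Metric.ball_mem_nhds p (half_pos hε))
    (inter_mem self_mem_nhdsWithin (mem_nhdsWithin_of_mem_nhds hh))]
  rintro ⟨⟨u, w⟩, h⟩ ⟨hz, h0, h1, h2, h3, h4⟩
  simp only at hz h0 h1 h2 h3 h4 ⊢
  have h0' : 0 < h := h0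
  obtain ⟨x, q, hx0, hxh, hsol⟩ := exists_boundary_value_solution hK hB h0' h1.le h2 u w
  have hw : ‖w‖ ≤ ‖p.2‖ + ε / 2 := by
    have e1 : dist w p.2 < ε / 2 := lt_of_le_of_lt (le_max_right _ _) (Metric.mem_ball.1 hz)
    have e2 := norm_add_le p.2 (w - p.2)
    rw [add_sub_cancel, ← dist_eq_norm] at e2
    linarith
  have hw' : 2 * h * (‖w‖ + 4 * h * B) ≤ 2 * h * (‖p.2‖ + ε / 2 + 4 * h * B) := by gcongr
  refine ⟨x, q, hx0, hxh, fun t ht ↦ ?_⟩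
  obtain ⟨s1, s2, s3, s4⟩ := hsol t ht
  have hmem : (x t, q t) ∈ Metric.ball p ε := by
    have e1 : dist (x t, q t) (u, w) < ε / 2 := by
      rw [Prod.dist_eq, dist_eq_norm, dist_eq_norm]
      exact max_lt (by linarith) (by linarith)
    exact Metric.mem_ball.2 ((dist_triangle _ _ _).trans_lt
      (by linarith [Metric.mem_ball.1 hz]))
  have hmem' := hN' hmem
  refine ⟨s1, ?_, hmem'.1⟩
  have hone : χ (x t, q t) = 1 := hmem'.2
  simpa [H, hone] using s2

/-- Solutions of a smooth second order equation are smooth. -/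
theorem contDiffAt_of_second_order {F : E × E → E} {x q : ℝ → E} {t : ℝ} [CompleteSpace E]
    (hF : ∀ᶠ z in 𝓝 (x t, q t), ContDiffAt ℝ ∞ F z)
    (h : ∀ᶠ s in 𝓝 t, HasDerivAt x (q s) s ∧ HasDerivAt q (F (x s, q s)) s) :
    ContDiffAt ℝ ∞ x t := by
  have hcont : ContinuousAt (fun s ↦ (x s, q s)) t :=
    h.self_of_nhds.1.continuousAt.prodMk h.self_of_nhds.2.continuousAt
  obtain ⟨ε, hε, hs⟩ := Metric.nhds_basis_closedBall.eventually_iff.1 (h.and (hcont.eventually hF))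
  rw [Real.closedBall_eq_Icc] at hs
  have := ODE.contDiffOn_enat_Icc_of_hasDerivWithinAt (n := ⊤) (tmin := t - ε) (tmax := t + ε)
    (f := fun _ z ↦ (z.2, F z)) (α := fun s ↦ (x s, q s)) (u := {z | ContDiffAt ℝ ∞ F z})
    (fun z hz ↦ by
      have hz' : ContDiffAt ℝ ∞ F z.2 := hz.2
      exact (contDiffAt_snd.snd.prodMk (hz'.comp z contDiffAt_snd)).contDiffWithinAt)
    (fun s hs' ↦ ((hs hs').1.1.prodMk (hs hs').1.2).hasDerivWithinAt)
    (fun s hs' ↦ (hs hs').2)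
  exact (this.contDiffAt (Icc_mem_nhds (by linarith) (by linarith))).fst

/-- Local uniqueness for smooth second order equations. -/
theorem eventuallyEq_of_second_order {F : E × E → E} {x q y r : ℝ → E} {t : ℝ}
    (hF : ContDiffAt ℝ 1 F (x t, q t))
    (hx : ∀ᶠ s in 𝓝 t, HasDerivAt x (q s) s ∧ HasDerivAt q (F (x s, q s)) s)
    (hy : ∀ᶠ s in 𝓝 t, HasDerivAt y (r s) s ∧ HasDerivAt r (F (y s, r s)) s)
    (hxy : x t = y t) (hqr : q t = r t) : x =ᶠ[𝓝 t] y := by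
  obtain ⟨K, N, hN, hK⟩ := (contDiffAt_snd.prodMk hF).exists_lipschitzOnWith
  have aux : ∀ {x q : ℝ → E}, N ∈ 𝓝 (x t, q t) →
      (∀ᶠ s in 𝓝 t, HasDerivAt x (q s) s ∧ HasDerivAt q (F (x s, q s)) s) →
      ∀ᶠ s in 𝓝 t, HasDerivAt (fun s ↦ (x s, q s)) (q s, F (x s, q s)) s ∧ (x s, q s) ∈ N := by
    intro x q hN h
    have hcont : ContinuousAt (fun s ↦ (x s, q s)) t :=
      h.self_of_nhds.1.continuousAt.prodMk h.self_of_nhds.2.continuousAt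
    filter_upwards [h, hcont.eventually hN] with s hs hs'
    exact ⟨hs.1.prodMk hs.2, hs'⟩
  have := ODE_solution_unique_of_eventually (v := fun _ z ↦ (z.2, F z)) (s := fun _ ↦ N)
    (.of_forall fun _ ↦ hK) (aux hN hx) (aux (hxy ▸ hqr ▸ hN) hy) (by simp [hxy, hqr])
  exact this.mono fun s hs ↦ congrArg Prod.fst hs

end SecondOrder
end

/-! ### The metric and its connection in charts -/

noncomputable section

section Pullback

variable {E : Type*} [NormedAddCommGroup E] [NormedSpace ℝ E]

/-- The derivative of the pull-back of a bilinear form. -/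
lemma fderiv_pullback_apply {G G' : E → E →L[ℝ] E →L[ℝ] ℝ} {φ : E → E} {u : E}
    (hG : DifferentiableAt ℝ G u) (hG' : DifferentiableAt ℝ G' (φ u)) (hφ : ContDiffAt ℝ 2 φ u)
    (h : ∀ᶠ z in 𝓝 u, ∀ v w, G z v w = G' (φ z) (fderiv ℝ φ z v) (fderiv ℝ φ z w)) (a v w : E) :
    fderiv ℝ G u a v w
      = fderiv ℝ G' (φ u) (fderiv ℝ φ u a) (fderiv ℝ φ u v) (fderiv ℝ φ u w)
        + G' (φ u) (fderiv ℝ (fderiv ℝ φ) u a v) (fderiv ℝ φ u w)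
        + G' (φ u) (fderiv ℝ φ u v) (fderiv ℝ (fderiv ℝ φ) u a w) := by
  have h1 := (hG.hasFDerivAt.clm_apply (hasFDerivAt_const v u)).clm_apply (hasFDerivAt_const w u)
  have hφ1 : HasFDerivAt φ (fderiv ℝ φ u) u := (hφ.differentiableAt (by norm_num)).hasFDerivAt
  have hφ2 : HasFDerivAt (fderiv ℝ φ) (fderiv ℝ (fderiv ℝ φ) u) u :=
    ((hφ.fderiv_right (m := 1) (by norm_num)).differentiableAt (by norm_num)).hasFDerivAt
  have hc : HasFDerivAt (fun z ↦ G' (φ z)) ((fderiv ℝ G' (φ u)).comp (fderiv ℝ φ u)) u :=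
    HasFDerivAt.comp (g := G') (f := φ) u hG'.hasFDerivAt hφ1
  have hv : ∀ v, HasFDerivAt (fun z ↦ fderiv ℝ φ z v) ((fderiv ℝ (fderiv ℝ φ) u).flip v) u :=
    fun v ↦ by simpa using hφ2.clm_apply (hasFDerivAt_const v u)
  have h2 := (hc.clm_apply (hv v)).clm_apply (hv w)
  have h3 := h1.unique (h2.congr_of_eventuallyEq (h.mono fun z hz ↦ hz v w))
  have h4 := congrArg (fun L ↦ L a) h3
  simp at h4
  linarith

set_option maxSynthPendingDepth 3 in
/-- The Levi-Civita spray of a smooth nondegenerate bilinear form is smooth. -/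
lemma contDiffAt_spray [CompleteSpace E] {G : E → E →L[ℝ] E →L[ℝ] ℝ} {p : E × E}
    (hG : ContDiffAt ℝ ∞ G p.1) (hinv : (G p.1).IsInvertible) :
    ContDiffAt ℝ ∞ (fun z : E × E ↦ -(G z.1).inverse ((1 / 2 : ℝ) • (fderiv ℝ G z.1 z.2 z.2
      + fderiv ℝ G z.1 z.2 z.2 - ((fderiv ℝ G z.1).flip z.2).flip z.2))) p := by
  have h0 : ContDiffAt ℝ ∞ (fun z : E × E ↦ (G z.1).inverse) p :=
    ContDiffAt.comp (g := ContinuousLinearMap.inverse) (f := fun z : E × E ↦ G z.1) p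
      hinv.contDiffAt_map_inverse (hG.comp p contDiffAt_fst)
  have hD : ContDiffAt ℝ ∞ (fun z : E × E ↦ fderiv ℝ G z.1) p :=
    (hG.fderiv_right (m := ∞) (by simp)).comp p contDiffAt_fst
  have h1 : ContDiffAt ℝ ∞ (fun z : E × E ↦ fderiv ℝ G z.1 z.2 z.2) p :=
    (hD.clm_apply contDiffAt_snd).clm_apply contDiffAt_snd
  have h2 : ContDiffAt ℝ ∞ (fun z : E × E ↦ (fderiv ℝ G z.1).flip z.2) p :=
    ((ContinuousLinearMap.flipₗᵢ ℝ E E (E →L[ℝ] ℝ)).contDiff.contDiffAt.comp p hD).clm_apply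
      contDiffAt_snd
  have h3 : ContDiffAt ℝ ∞ (fun z : E × E ↦ ((fderiv ℝ G z.1).flip z.2).flip z.2) p :=
    ((ContinuousLinearMap.flipₗᵢ ℝ E E ℝ).contDiff.contDiffAt.comp p h2).clm_apply contDiffAt_snd
  exact (h0.clm_apply (((h1.add h1).sub h3).const_smul (1 / 2 : ℝ))).neg

end Pullback

set_option linter.unusedSectionVars false

namespace LorentzMetric

variable {n : ℕ} {M : Type*} [TopologicalSpace M]
  [ChartedSpace (EuclideanSpace ℝ (Fin n)) M] [IsManifold (𝓡 n) ∞ M]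
  (g : LorentzMetric n M) {e e' : OpenPartialHomeomorph M (EuclideanSpace ℝ (Fin n))}

lemma mdifferentiable_of_mem_maximalAtlas (he : e ∈ IsManifold.maximalAtlas (𝓡 n) ∞ M) :
    e.MDifferentiable (𝓡 n) (𝓡 n) :=
  ⟨(contMDiffOn_of_mem_maximalAtlas he).mdifferentiableOn (by simp),
    (contMDiffOn_symm_of_mem_maximalAtlas he).mdifferentiableOn (by simp)⟩

lemma mfderiv_symm_bijective (he : e ∈ IsManifold.maximalAtlas (𝓡 n) ∞ M)
    {u : EuclideanSpace ℝ (Fin n)} (hu : u ∈ e.target) :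
    Function.Bijective (mfderiv (𝓡 n) (𝓡 n) e.symm u) :=
  (mdifferentiable_of_mem_maximalAtlas he).symm.mfderiv_bijective hu

/-- The tangent map of `e.symm` is smooth and is applied to the constant section `v`. Evaluating the
metric on two such coordinate fields gives its components. -/
lemma contMDiffAt_mfderiv_symm (he : e ∈ IsManifold.maximalAtlas (𝓡 n) ∞ M)
    {u : EuclideanSpace ℝ (Fin n)} (hu : u ∈ e.target) (v : EuclideanSpace ℝ (Fin n)) :
    ContMDiffAt (𝓡 n) (𝓡 n).tangent ∞ (fun z ↦ (Bundle.TotalSpace.mk'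
      (EuclideanSpace ℝ (Fin n)) (E := fun x : M ↦ TangentSpace (𝓡 n) x) (e.symm z)
        (mfderiv (𝓡 n) (𝓡 n) e.symm z v))) u := by
  have h1 := (contMDiffOn_symm_of_mem_maximalAtlas he).contMDiffOn_tangentMapWithin (m := ∞)
    (by simp) e.open_target.uniqueMDiffOn
  have h2 : ContMDiffAt (𝓡 n) (𝓡 n).tangent ∞ (fun z ↦ (Bundle.TotalSpace.mk'
      (EuclideanSpace ℝ (Fin n)) (E := fun x : EuclideanSpace ℝ (Fin n) ↦ TangentSpace (𝓡 n) x) z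
        v)) u := contMDiffAt_vectorSpace_iff_contDiffAt.2 contDiffAt_const
  have h3 := (h1 _ (show (⟨u, v⟩ : TangentBundle (𝓡 n) (EuclideanSpace ℝ (Fin n))) ∈ _ from hu))
  have h4 := (h3.contMDiffAt ((FiberBundle.continuous_proj _ _).continuousAt.preimage_mem_nhds
    (e.open_target.mem_nhds hu))).comp u h2
  refine h4.congr_of_eventuallyEq ?_
  filter_upwards [e.open_target.mem_nhds hu] with z hz
  simp [tangentMapWithin, mfderivWithin_of_isOpen e.open_target hz]

lemma contDiffOn_inChart (he : e ∈ IsManifold.maximalAtlas (𝓡 n) ∞ M) :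
    ContDiffOn ℝ ∞ (g.inChart e) e.target := by
  rw [contDiffOn_clm_apply]
  intro v
  rw [contDiffOn_clm_apply]
  intro w u hu
  refine ContDiffAt.contDiffWithinAt (ContMDiffAt.contDiffAt ?_)
  have hb : ContMDiffAt (𝓡 n) (𝓡 n) ∞ e.symm u :=
    (contMDiffOn_symm_of_mem_maximalAtlas he).contMDiffAt (e.open_target.mem_nhds hu)
  have : ContMDiffAt (𝓡 n) ((𝓡 n).prod 𝓘(ℝ)) ∞
      (fun z ↦ Bundle.TotalSpace.mk' ℝ (E := Bundle.Trivial M ℝ) (e.symm z)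
        (g.val (e.symm z) (mfderiv (𝓡 n) (𝓡 n) e.symm z v)
          (mfderiv (𝓡 n) (𝓡 n) e.symm z w))) u :=
    ContMDiffAt.clm_bundle_apply₂ (F₁ := EuclideanSpace ℝ (Fin n))
      (F₂ := EuclideanSpace ℝ (Fin n)) (g.smooth.contMDiffAt.comp u hb)
      (contMDiffAt_mfderiv_symm he hu v) (contMDiffAt_mfderiv_symm he hu w)
  simp only [Bundle.contMDiffAt_totalSpace] at this
  exact this.2

lemma contDiffAt_inChart (he : e ∈ IsManifold.maximalAtlas (𝓡 n) ∞ M)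
    {u : EuclideanSpace ℝ (Fin n)} (hu : u ∈ e.target) : ContDiffAt ℝ ∞ (g.inChart e) u :=
  (g.contDiffOn_inChart he).contDiffAt (e.open_target.mem_nhds hu)

lemma inChart_apply (u v w : EuclideanSpace ℝ (Fin n)) :
    g.inChart e u v w = g.val (e.symm u) (mfderiv (𝓡 n) (𝓡 n) e.symm u v)
      (mfderiv (𝓡 n) (𝓡 n) e.symm u w) := rfl

lemma isLorentzForm_inChart (hn : n ≠ 0) (he : e ∈ IsManifold.maximalAtlas (𝓡 n) ∞ M)
    {u : EuclideanSpace ℝ (Fin n)} (hu : u ∈ e.target) : IsLorentzForm (g.inChart e u) := by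
  obtain ⟨m, rfl⟩ := Nat.exists_eq_succ_of_ne_zero hn
  obtain ⟨b, hb⟩ := g.lorentzian (e.symm u)
  have h : IsLorentzForm (E := EuclideanSpace ℝ (Fin (m + 1))) (g.val (e.symm u)) :=
    IsLorentzForm.of_basis (E := EuclideanSpace ℝ (Fin (m + 1))) b hb
  exact h.comp _ (mfderiv_symm_bijective he hu).1 (mfderiv_symm_bijective he hu).2

lemma inChart_christoffel (hn : n ≠ 0) (he : e ∈ IsManifold.maximalAtlas (𝓡 n) ∞ M)
    {u : EuclideanSpace ℝ (Fin n)} (hu : u ∈ e.target) (v w : EuclideanSpace ℝ (Fin n)) :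
    g.inChart e u (g.christoffel e u v w) = g.christoffelLower e u v w := by
  have h := (g.isLorentzForm_inChart hn he hu).isInvertible
  exact h.self_apply_inverse _

lemma contDiffAt_christoffel (hn : n ≠ 0) (he : e ∈ IsManifold.maximalAtlas (𝓡 n) ∞ M)
    {p : EuclideanSpace ℝ (Fin n) × EuclideanSpace ℝ (Fin n)} (hp : p.1 ∈ e.target) :
    ContDiffAt ℝ ∞ (fun z : EuclideanSpace ℝ (Fin n) × EuclideanSpace ℝ (Fin n) ↦
      -g.christoffel e z.1 z.2 z.2) p := by
  exact contDiffAt_spray (g.contDiffAt_inChart he hp)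
    (g.isLorentzForm_inChart hn he hp).isInvertible

/-- The transition map between two charts. -/
lemma contDiffAt_transition (he : e ∈ IsManifold.maximalAtlas (𝓡 n) ∞ M)
    (he' : e' ∈ IsManifold.maximalAtlas (𝓡 n) ∞ M) {u : EuclideanSpace ℝ (Fin n)}
    (hu : u ∈ e.target) (hu' : e.symm u ∈ e'.source) :
    ContDiffAt ℝ ∞ (e' ∘ e.symm) u :=
  (((contMDiffOn_of_mem_maximalAtlas he').contMDiffAt (e'.open_source.mem_nhds hu')).comp u
    ((contMDiffOn_symm_of_mem_maximalAtlas he).contMDiffAt (e.open_target.mem_nhds hu))).contDiffAt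

/-- The reverse transition map provides a right inverse. Surjectivity allows covectors in the new
chart to be tested only on images of vectors of the old one. -/
lemma fderiv_transition_surjective (he : e ∈ IsManifold.maximalAtlas (𝓡 n) ∞ M)
    (he' : e' ∈ IsManifold.maximalAtlas (𝓡 n) ∞ M) {u : EuclideanSpace ℝ (Fin n)}
    (hu : u ∈ e.target) (hu' : e.symm u ∈ e'.source) :
    Function.Surjective (fderiv ℝ (e' ∘ e.symm) u) := by
  have h1 := contDiffAt_transition he he' hu hu'
  have h2 : ContDiffAt ℝ ∞ (e ∘ e'.symm) ((e' ∘ e.symm) u) :=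
    contDiffAt_transition he' he (e'.map_source hu')
      (by simpa [e'.left_inv hu'] using e.map_target hu)
  have hpt : (e ∘ e'.symm) ((e' ∘ e.symm) u) = u := by simp [e'.left_inv hu', e.right_inv hu]
  have hid : (e' ∘ e.symm) ∘ (e ∘ e'.symm) =ᶠ[𝓝 ((e' ∘ e.symm) u)] id := by
    have hc : e'.symm ((e' ∘ e.symm) u) ∈ e.source := by
      simpa [e'.left_inv hu'] using e.map_target hu
    filter_upwards [e'.open_target.mem_nhds (e'.map_source hu'),
      (e'.symm.continuousAt (e'.map_source hu')).preimage_mem_nhds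
        (e.open_source.mem_nhds hc)] with z hz hz'
    simp [e.left_inv hz', e'.right_inv hz]
  intro z
  refine ⟨fderiv ℝ (e ∘ e'.symm) ((e' ∘ e.symm) u) z, ?_⟩
  have h3 := fderiv_comp ((e' ∘ e.symm) u) (g := e' ∘ e.symm)
    (by rw [hpt]; exact h1.differentiableAt (by simp)) (h2.differentiableAt (by simp))
  rw [hid.fderiv_eq, fderiv_id, hpt] at h3
  exact (congrArg (fun L ↦ L z) h3).symm

lemma inChart_transition (he : e ∈ IsManifold.maximalAtlas (𝓡 n) ∞ M)
    (he' : e' ∈ IsManifold.maximalAtlas (𝓡 n) ∞ M) {u : EuclideanSpace ℝ (Fin n)}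
    (hu : u ∈ e.target) (hu' : e.symm u ∈ e'.source) (v w : EuclideanSpace ℝ (Fin n)) :
    g.inChart e u v w = g.inChart e' ((e' ∘ e.symm) u) (fderiv ℝ (e' ∘ e.symm) u v)
      (fderiv ℝ (e' ∘ e.symm) u w) := by
  have hy : (e' ∘ e.symm) u ∈ e'.target := e'.map_source hu'
  have hφ : MDifferentiableAt (𝓡 n) (𝓡 n) (e' ∘ e.symm) u :=
    ((contDiffAt_transition he he' hu hu').contMDiffAt).mdifferentiableAt (by simp)
  have heq : e.symm =ᶠ[𝓝 u] e'.symm ∘ (e' ∘ e.symm) := by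
    filter_upwards [e.symm.open_source.mem_nhds hu,
      (e.symm.continuousAt hu).preimage_mem_nhds (e'.open_source.mem_nhds hu')] with z hz hz'
    simp [e'.left_inv hz']
  have hpt : e'.symm ((e' ∘ e.symm) u) = e.symm u := e'.left_inv hu'
  -- The base points `e'.symm ((e' ∘ e.symm) u)` and `e.symm u` are equal only propositionally, so
  -- vectors are compared in the model space.
  have key : ∀ (x y : M) (_ : x = y) (a b : EuclideanSpace ℝ (Fin n)),
      (g.val x : EuclideanSpace ℝ (Fin n) →L[ℝ] EuclideanSpace ℝ (Fin n) →L[ℝ] ℝ) a b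
      = (g.val y : EuclideanSpace ℝ (Fin n) →L[ℝ] EuclideanSpace ℝ (Fin n) →L[ℝ] ℝ) a b := by
    rintro x _ rfl a b
    rfl
  have hDv : ∀ a : EuclideanSpace ℝ (Fin n), (mfderiv (𝓡 n) (𝓡 n) e.symm u a :
      EuclideanSpace ℝ (Fin n)) = mfderiv (𝓡 n) (𝓡 n) e'.symm ((e' ∘ e.symm) u)
        (fderiv ℝ (e' ∘ e.symm) u a) := fun a ↦ by
    have h1 := heq.mfderiv_eq (I := 𝓡 n) (I' := 𝓡 n)
    rw [mfderiv_comp u ((mdifferentiable_of_mem_maximalAtlas he').mdifferentiableAt_symm hy) hφ,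
      mfderiv_eq_fderiv] at h1
    exact congrArg (fun L : EuclideanSpace ℝ (Fin n) →L[ℝ] EuclideanSpace ℝ (Fin n) ↦ L a) h1
  rw [inChart_apply, inChart_apply]
  refine (key _ _ hpt.symm _ _).trans ?_
  rw [hDv v, hDv w]

/-- The transformation law of the Christoffel symbols under a change of chart. -/
lemma christoffelLower_transition (hn : n ≠ 0) (he : e ∈ IsManifold.maximalAtlas (𝓡 n) ∞ M)
    (he' : e' ∈ IsManifold.maximalAtlas (𝓡 n) ∞ M) {u : EuclideanSpace ℝ (Fin n)}
    (hu : u ∈ e.target) (hu' : e.symm u ∈ e'.source) (v w z : EuclideanSpace ℝ (Fin n)) :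
    g.christoffelLower e u v w z
      = g.christoffelLower e' ((e' ∘ e.symm) u) (fderiv ℝ (e' ∘ e.symm) u v)
          (fderiv ℝ (e' ∘ e.symm) u w) (fderiv ℝ (e' ∘ e.symm) u z)
        + g.inChart e' ((e' ∘ e.symm) u) (fderiv ℝ (fderiv ℝ (e' ∘ e.symm)) u v w)
          (fderiv ℝ (e' ∘ e.symm) u z) := by
  have hy : (e' ∘ e.symm) u ∈ e'.target := e'.map_source hu'
  have hφ := contDiffAt_transition he he' hu hu'
  have hsymm := (hφ.isSymmSndFDerivAt (by
    simpa using (ENat.LEInfty.out : (2 : WithTop ℕ∞) ≤ ∞))).eq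
  have hev : ∀ᶠ z in 𝓝 u, ∀ v w, g.inChart e z v w = g.inChart e' ((e' ∘ e.symm) z)
      (fderiv ℝ (e' ∘ e.symm) z v) (fderiv ℝ (e' ∘ e.symm) z w) := by
    filter_upwards [e.symm.open_source.mem_nhds hu,
      (e.symm.continuousAt hu).preimage_mem_nhds (e'.open_source.mem_nhds hu')] with z hz hz'
    exact g.inChart_transition he he' hz hz'
  have key := fderiv_pullback_apply ((g.contDiffAt_inChart he hu).differentiableAt (by simp))
    ((g.contDiffAt_inChart he' hy).differentiableAt (by simp)) (hφ.of_le (ENat.LEInfty.out))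
    hev
  have hs := (g.isLorentzForm_inChart hn he' hy).symm
  simp only [christoffelLower, _root_.smul_apply, _root_.sub_apply, _root_.add_apply,
    ContinuousLinearMap.flip_apply, key, smul_eq_mul]
  -- By symmetry of the form and of the second derivative, four of the six second-derivative terms
  -- cancel; the remaining two agree and absorb the factor `1 / 2`.
  rw [hsymm w v, hsymm z v, hsymm z w, hs (fderiv ℝ (e' ∘ e.symm) u w),
    hs (fderiv ℝ (e' ∘ e.symm) u v)]
  ring

/-- The geodesic equation is independent of the chart. -/
lemma geodesic_equation_transition (hn : n ≠ 0) (he : e ∈ IsManifold.maximalAtlas (𝓡 n) ∞ M)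
    (he' : e' ∈ IsManifold.maximalAtlas (𝓡 n) ∞ M) {c : ℝ → EuclideanSpace ℝ (Fin n)} {t : ℝ}
    (hu : c t ∈ e.target) (hu' : e.symm (c t) ∈ e'.source) (hc : ContDiffAt ℝ 2 c t)
    (h : deriv (deriv c) t + g.christoffel e (c t) (deriv c t) (deriv c t) = 0) :
    deriv (deriv ((e' ∘ e.symm) ∘ c)) t + g.christoffel e' ((e' ∘ e.symm) (c t))
      (deriv ((e' ∘ e.symm) ∘ c) t) (deriv ((e' ∘ e.symm) ∘ c) t) = 0 := by
  have hy : (e' ∘ e.symm) (c t) ∈ e'.target := e'.map_source hu'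
  have hφ := contDiffAt_transition he he' hu hu'
  set φ := e' ∘ e.symm with hφdef
  have hφ2 : ContDiffAt ℝ 2 φ (c t) := hφ.of_le (ENat.LEInfty.out)
  have hcd : ∀ᶠ s in 𝓝 t, HasDerivAt (φ ∘ c) (fderiv ℝ φ (c s) (deriv c s)) s := by
    filter_upwards [hc.eventually (by simp), hc.continuousAt.eventually (hφ2.eventually (by simp))]
      with s hs hs'
    exact (hs'.differentiableAt (by simp)).hasFDerivAt.comp_hasDerivAt s
      (hs.differentiableAt (by simp)).hasDerivAt
  have h1 : deriv (φ ∘ c) =ᶠ[𝓝 t] fun s ↦ fderiv ℝ φ (c s) (deriv c s) :=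
    hcd.mono fun s hs ↦ hs.deriv
  have hc1 : HasDerivAt c (deriv c t) t := (hc.differentiableAt (by simp)).hasDerivAt
  have hc2 : HasDerivAt (deriv c) (deriv (deriv c) t) t := by
    refine DifferentiableAt.hasDerivAt ?_
    have := (hc.fderiv_right (m := 1) (by norm_num)).differentiableAt (by simp)
    exact this.clm_apply (differentiableAt_const (1 : ℝ))
  have hD : HasFDerivAt (fderiv ℝ φ) (fderiv ℝ (fderiv ℝ φ) (c t)) (c t) :=
    ((hφ2.fderiv_right (m := 1) (by norm_num)).differentiableAt (by simp)).hasFDerivAt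
  have h2 : deriv (deriv (φ ∘ c)) t = fderiv ℝ (fderiv ℝ φ) (c t) (deriv c t) (deriv c t)
      + fderiv ℝ φ (c t) (deriv (deriv c) t) := by
    rw [h1.deriv_eq]
    exact ((hD.comp_hasDerivAt t hc1).clm_apply hc2).deriv
  -- Nondegeneracy lets the equation be lowered to covectors. The inhomogeneous term of
  -- `christoffelLower_transition` is then exactly the second-derivative term of `h2`.
  have hinj : ∀ a, (∀ z, g.inChart e' (φ (c t)) a (fderiv ℝ φ (c t) z) = 0) → a = 0 := by
    intro a ha
    refine (g.isLorentzForm_inChart hn he' hy).eq_zero_of_forall fun z ↦ ?_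
    obtain ⟨z', rfl⟩ := fderiv_transition_surjective he he' hu hu' z
    exact ha z'
  rw [h1.self_of_nhds, h2]
  refine hinj _ fun z ↦ ?_
  have e1 := congrArg (fun v ↦ g.inChart e (c t) v z) h
  simp only [map_add, _root_.add_apply, map_zero, _root_.zero_apply,
    g.inChart_christoffel hn he hu, g.inChart_christoffel hn he' hy] at e1 ⊢
  rw [g.christoffelLower_transition hn he he' hu hu', g.inChart_transition he he' hu hu'] at e1
  rw [← hφdef] at e1
  linarith

end LorentzMetric

end

/-! ### Geodesics and their velocities -/

noncomputable section

set_option linter.unusedSectionVars false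

variable {n : ℕ} {M : Type*} [TopologicalSpace M]
  [ChartedSpace (EuclideanSpace ℝ (Fin n)) M] [IsManifold (𝓡 n) ∞ M]
  {g : LorentzMetric n M} {e : OpenPartialHomeomorph M (EuclideanSpace ℝ (Fin n))}

/-- `γ` is smooth near `t` and satisfies the geodesic equation at `t`. -/
def IsGeodesicAt (g : LorentzMetric n M) (γ : ℝ → M) (t : ℝ) : Prop :=
  ContMDiffAt 𝓘(ℝ, ℝ) (𝓡 n) ∞ γ t ∧
  ∀ e ∈ IsManifold.maximalAtlas (𝓡 n) ∞ M, γ t ∈ e.source →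
    deriv (deriv (e ∘ γ)) t
      + g.christoffel e (e (γ t)) (deriv (e ∘ γ) t) (deriv (e ∘ γ) t) = 0

lemma isGeodesicOn_iff {γ : ℝ → M} {J : Set ℝ} (hJ : IsOpen J) :
    IsGeodesicOn g γ J ↔ ∀ t ∈ J, IsGeodesicAt g γ t :=
  ⟨fun h t ht ↦ ⟨h.1.contMDiffAt (hJ.mem_nhds ht), h.2 t ht⟩,
    fun h ↦ ⟨fun t ht ↦ (h t ht).1.contMDiffWithinAt, fun t ht ↦ (h t ht).2⟩⟩

lemma IsGeodesicSegment.isGeodesicAt {γ : ℝ → M} {a b : ℝ} (h : IsGeodesicSegment g γ a b) {t : ℝ}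
    (ht : t ∈ Icc a b) : IsGeodesicAt g γ t := by
  obtain ⟨-, a', b', ha, hb, hγ⟩ := h
  exact (isGeodesicOn_iff isOpen_Ioo).1 hγ t ⟨ha.trans_le ht.1, ht.2.trans_lt hb⟩

lemma IsGeodesicSegment.eventually_isGeodesicAt {γ : ℝ → M} {a b : ℝ}
    (h : IsGeodesicSegment g γ a b) {t : ℝ} (ht : t ∈ Icc a b) :
    ∀ᶠ s in 𝓝 t, IsGeodesicAt g γ s := by
  obtain ⟨-, a', b', ha, hb, hγ⟩ := h
  filter_upwards [Ioo_mem_nhds (ha.trans_le ht.1) (ht.2.trans_lt hb)] with s hs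
  exact (isGeodesicOn_iff isOpen_Ioo).1 hγ s hs

lemma IsGeodesicSegment.mono {γ : ℝ → M} {a b a₁ b₁ : ℝ} (h : IsGeodesicSegment g γ a b)
    (h₁ : a₁ < b₁) (ha : a ≤ a₁) (hb : b₁ ≤ b) : IsGeodesicSegment g γ a₁ b₁ := by
  obtain ⟨-, a', b', ha', hb', hγ⟩ := h
  exact ⟨h₁, a', b', ha'.trans_le ha, hb.trans_lt hb', hγ⟩

namespace IsGeodesicAt

lemma congr {γ γ' : ℝ → M} {t : ℝ} (h : IsGeodesicAt g γ t) (heq : γ' =ᶠ[𝓝 t] γ) :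
    IsGeodesicAt g γ' t := by
  refine ⟨h.1.congr_of_eventuallyEq heq, fun e he hs ↦ ?_⟩
  have h1 : e ∘ γ' =ᶠ[𝓝 t] e ∘ γ := heq.fun_comp e
  have h2 : γ' t = γ t := heq.self_of_nhds
  rw [h1.deriv.deriv_eq, h1.deriv_eq, h2]
  exact h.2 e he (h2 ▸ hs)

/-- The Christoffel term is quadratic in the velocity, so both terms of the equation are multiplied
by `k ^ 2`. Gluing needs this, as the two tangent vectors are only proportional. -/
lemma comp_affine {γ : ℝ → M} {k m t : ℝ} (h : IsGeodesicAt g γ (k * t + m)) :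
    IsGeodesicAt g (fun s ↦ γ (k * s + m)) t := by
  refine ⟨?_, fun e he hs ↦ ?_⟩
  · have : ContMDiffAt 𝓘(ℝ, ℝ) 𝓘(ℝ, ℝ) ∞ (fun s : ℝ ↦ k * s + m) t :=
      ContDiffAt.contMDiffAt (by fun_prop)
    exact ContMDiffAt.comp t (g := γ) h.1 this
  · have hd : ∀ c : ℝ → EuclideanSpace ℝ (Fin n),
        deriv (fun s ↦ c (k * s + m)) = fun s ↦ k • deriv c (k * s + m) := fun c ↦ by
      funext s
      have := deriv_comp_mul_left k (fun r ↦ c (r + m)) s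
      rw [this, deriv_comp_add_const]
    have h0 := h.2 e he hs
    have h1 := hd (e ∘ γ)
    have h2 : e ∘ (fun s ↦ γ (k * s + m)) = fun s ↦ (e ∘ γ) (k * s + m) := rfl
    have h3 : deriv (fun s ↦ k • deriv (e ∘ γ) (k * s + m)) t
        = k • k • deriv (deriv (e ∘ γ)) (k * t + m) := by
      rw [deriv_fun_const_smul_field, hd]
    rw [h2, h1, h3]
    have h4 : ∀ u v : EuclideanSpace ℝ (Fin n),
        g.christoffel e u (k • v) (k • v) = k • k • g.christoffel e u v v := fun u v ↦ by
      rw [LorentzMetric.christoffel, LorentzMetric.christoffel, ← map_smul, ← map_smul]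
      congr 1
      ext z
      simp [LorentzMetric.christoffelLower]
      ring
    rw [h4, ← smul_add, ← smul_add, h0, smul_zero, smul_zero]

lemma contDiffAt_chart {γ : ℝ → M} {t : ℝ} (h : IsGeodesicAt g γ t)
    (he : e ∈ IsManifold.maximalAtlas (𝓡 n) ∞ M) (ht : γ t ∈ e.source) :
    ContDiffAt ℝ ∞ (e ∘ γ) t :=
  (((contMDiffOn_of_mem_maximalAtlas he).contMDiffAt (e.open_source.mem_nhds ht)).comp t
    h.1).contDiffAt

lemma hasStrictDerivAt_chart {γ : ℝ → M} {t : ℝ} (h : IsGeodesicAt g γ t)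
    (he : e ∈ IsManifold.maximalAtlas (𝓡 n) ∞ M) (ht : γ t ∈ e.source) :
    HasStrictDerivAt (e ∘ γ) (deriv (e ∘ γ) t) t :=
  (h.contDiffAt_chart he ht).hasStrictDerivAt (by simp)

lemma hasDerivAt_deriv_chart {γ : ℝ → M} {t : ℝ} (h : IsGeodesicAt g γ t)
    (he : e ∈ IsManifold.maximalAtlas (𝓡 n) ∞ M) (ht : γ t ∈ e.source) :
    HasDerivAt (deriv (e ∘ γ))
      (-g.christoffel e (e (γ t)) (deriv (e ∘ γ) t) (deriv (e ∘ γ) t)) t := by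
  have h1 : DifferentiableAt ℝ (deriv (e ∘ γ)) t :=
    (((h.contDiffAt_chart he ht).fderiv_right (m := ∞) (by simp)).differentiableAt
      (by simp)).clm_apply (differentiableAt_const (1 : ℝ))
  rw [← eq_neg_of_add_eq_zero_left (h.2 e he ht)]
  exact h1.hasDerivAt

/-- A solution of the geodesic equation in one chart is a geodesic. -/
lemma symm_comp (hn : n ≠ 0) (he : e ∈ IsManifold.maximalAtlas (𝓡 n) ∞ M)
    {c : ℝ → EuclideanSpace ℝ (Fin n)} {t : ℝ} (hc : ContDiffAt ℝ ∞ c t) (ht : c t ∈ e.target)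
    (h : deriv (deriv c) t + g.christoffel e (c t) (deriv c t) (deriv c t) = 0) :
    IsGeodesicAt g (e.symm ∘ c) t := by
  refine ⟨((contMDiffOn_symm_of_mem_maximalAtlas he).contMDiffAt (e.open_target.mem_nhds ht)).comp t
    hc.contMDiffAt, fun e' he' hs ↦ ?_⟩
  exact g.geodesic_equation_transition hn he he' ht hs (hc.of_le ENat.LEInfty.out) h

/-- Geodesics with the same initial position and velocity agree. -/
lemma eventuallyEq (hn : n ≠ 0) (he : e ∈ IsManifold.maximalAtlas (𝓡 n) ∞ M) {γ γ' : ℝ → M} {t : ℝ}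
    (h : ∀ᶠ s in 𝓝 t, IsGeodesicAt g γ s) (h' : ∀ᶠ s in 𝓝 t, IsGeodesicAt g γ' s)
    (ht : γ t ∈ e.source) (heq : γ t = γ' t) (hd : deriv (e ∘ γ) t = deriv (e ∘ γ') t) :
    γ =ᶠ[𝓝 t] γ' := by
  have hsrc : ∀ {γ : ℝ → M}, (∀ᶠ s in 𝓝 t, IsGeodesicAt g γ s) → γ t ∈ e.source →
      ∀ᶠ s in 𝓝 t, γ s ∈ e.source := fun h ht ↦
    h.self_of_nhds.1.continuousAt.eventually_mem (e.open_source.mem_nhds ht)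
  have hsol : ∀ {γ : ℝ → M}, (∀ᶠ s in 𝓝 t, IsGeodesicAt g γ s) → γ t ∈ e.source →
      ∀ᶠ s in 𝓝 t, HasDerivAt (e ∘ γ) (deriv (e ∘ γ) s) s ∧ HasDerivAt (deriv (e ∘ γ))
        (-g.christoffel e ((e ∘ γ) s) (deriv (e ∘ γ) s) (deriv (e ∘ γ) s)) s := by
    intro γ h ht
    filter_upwards [h, hsrc h ht] with s hs hs'
    exact ⟨(hs.hasStrictDerivAt_chart he hs').hasDerivAt, hs.hasDerivAt_deriv_chart he hs'⟩
  have key := eventuallyEq_of_second_order (F := fun z ↦ -g.christoffel e z.1 z.2 z.2)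
    (x := e ∘ γ) (y := e ∘ γ') (q := deriv (e ∘ γ)) (r := deriv (e ∘ γ'))
    ((g.contDiffAt_christoffel hn he (p := ((e ∘ γ) t, deriv (e ∘ γ) t)) (e.map_source ht)).of_le
      (by simp)) (hsol h ht) (hsol h' (heq ▸ ht)) (congrArg e heq) hd
  filter_upwards [key, hsrc h ht, hsrc h' (heq ▸ ht)] with s hs h1 h2
  exact e.injOn h1 h2 hs

end IsGeodesicAt

section Velocity

lemma velocity_congr {γ γ' : ℝ → M} {t : ℝ} (h : γ =ᶠ[𝓝 t] γ') :
    (velocity n γ t : EuclideanSpace ℝ (Fin n)) = velocity n γ' t := by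
  have := h.mfderiv_eq (I := 𝓘(ℝ, ℝ)) (I' := 𝓡 n)
  exact congrArg (fun L : ℝ →L[ℝ] EuclideanSpace ℝ (Fin n) ↦ L 1) this

lemma velocity_symm_comp (he : e ∈ IsManifold.maximalAtlas (𝓡 n) ∞ M)
    {c : ℝ → EuclideanSpace ℝ (Fin n)} {v : EuclideanSpace ℝ (Fin n)} {t : ℝ}
    (hc : HasDerivAt c v t) (ht : c t ∈ e.target) :
    velocity n (e.symm ∘ c) t = mfderiv (𝓡 n) (𝓡 n) e.symm (c t) v := by
  have h1 : HasMFDerivAt 𝓘(ℝ, ℝ) (𝓡 n) c t (ContinuousLinearMap.toSpanSingleton ℝ v) :=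
    hc.hasFDerivAt.hasMFDerivAt
  have h2 := (((LorentzMetric.mdifferentiable_of_mem_maximalAtlas he).mdifferentiableAt_symm
    ht).hasMFDerivAt.comp t h1).mfderiv
  rw [velocity, h2]
  change mfderiv (𝓡 n) (𝓡 n) e.symm (c t) ((1 : ℝ) • v) = _
  rw [one_smul]

lemma velocity_eq (he : e ∈ IsManifold.maximalAtlas (𝓡 n) ∞ M) {γ : ℝ → M} {t : ℝ}
    (h : IsGeodesicAt g γ t) (ht : γ t ∈ e.source) :
    (velocity n γ t : EuclideanSpace ℝ (Fin n))
      = mfderiv (𝓡 n) (𝓡 n) e.symm (e (γ t)) (deriv (e ∘ γ) t) := by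
  have heq : γ =ᶠ[𝓝 t] e.symm ∘ (e ∘ γ) := by
    filter_upwards [h.1.continuousAt.eventually_mem (e.open_source.mem_nhds ht)] with s hs
    simp [e.left_inv hs]
  exact (velocity_congr heq).trans
    (velocity_symm_comp he (h.hasStrictDerivAt_chart he ht).hasDerivAt (e.map_source ht))

lemma velocity_comp_affine {γ : ℝ → M} {k m t : ℝ}
    (h : MDifferentiableAt 𝓘(ℝ, ℝ) (𝓡 n) γ (k * t + m)) :
    velocity n (fun s ↦ γ (k * s + m)) t = k • velocity n γ (k * t + m) := by
  have h1 : HasDerivAt (fun s : ℝ ↦ k * s + m) k t := by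
    simpa using ((hasDerivAt_id t).const_mul k).add_const m
  have h2 := (h.hasMFDerivAt.comp t h1.hasFDerivAt.hasMFDerivAt).mfderiv
  have h3 : velocity n (γ ∘ fun s : ℝ ↦ k * s + m) t
      = mfderiv 𝓘(ℝ, ℝ) (𝓡 n) γ (k * t + m) ((1 : ℝ) • k) :=
    congrArg (fun L : ℝ →L[ℝ] EuclideanSpace ℝ (Fin n) ↦ L 1) h2
  have h4 : ∀ L : ℝ →L[ℝ] EuclideanSpace ℝ (Fin n), L ((1 : ℝ) • k) = k • L 1 := fun L ↦ by
    rw [← map_smul, smul_eq_mul, smul_eq_mul, one_mul, mul_one]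
  exact h3.trans (h4 _)

end Velocity

lemma LorentzMetric.isLorentzForm_val (hn : n ≠ 0) (g : LorentzMetric n M) (x : M) :
    IsLorentzForm (E := EuclideanSpace ℝ (Fin n)) (g.val x) := by
  obtain ⟨m, rfl⟩ := Nat.exists_eq_succ_of_ne_zero hn
  obtain ⟨b, hb⟩ := g.lorentzian x
  exact IsLorentzForm.of_basis (E := EuclideanSpace ℝ (Fin (m + 1))) b hb

/-! ### Time-orientation and future cones in charts -/

namespace TimeOrientation

variable (τ : TimeOrientation g)

/-- By `cone_eq`, every vector of a timecone determines that timecone, so the vector supplied by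
`isTimecone` may be exchanged for a convenient one. -/
lemma mem_cone_iff (hn : n ≠ 0) {x : M} {X : TangentSpace (𝓡 n) x} (hX : X ∈ τ.cone x)
    (v : TangentSpace (𝓡 n) x) : v ∈ τ.cone x ↔ 0 < g.val x v v ∧ 0 < g.val x X v := by
  obtain ⟨u, hu, hcone⟩ := τ.isTimecone x
  rw [hcone] at hX ⊢
  exact (g.isLorentzForm_val hn x).cone_eq hu hX.1 hX.2 v

/-- Being a limit of the cone gives only `≥ 0`; equality is excluded because a nonzero null vector
is never orthogonal to a timelike one. -/
lemma IsFutureNull.pos (hn : n ≠ 0) {x : M} {X v : TangentSpace (𝓡 n) x} (hX : X ∈ τ.cone x)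
    (hv : τ.IsFutureNull v) : 0 < g.val x X v := by
  have hXX := ((τ.mem_cone_iff hn hX X).1 hX).1
  have h0 : g.val x X v ≠ 0 := (g.isLorentzForm_val hn x).ne_zero_of_null hXX hv.1.1 hv.1.2
  refine lt_of_le_of_ne ?_ h0.symm
  have hsub : closure (τ.cone x) ⊆ {w | 0 ≤ g.val x X w} :=
    closure_minimal (fun w hw ↦ ((τ.mem_cone_iff hn hX w).1 hw).2.le)
      (isClosed_Ici.preimage (g.val x X).continuous)
  exact hsub hv.2

lemma IsFutureNull.smul {x : M} {v : TangentSpace (𝓡 n) x} (hv : τ.IsFutureNull v)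
    {k : ℝ} (hk : 0 < k) : τ.IsFutureNull (k • v) := by
  obtain ⟨u, hu, hcone⟩ := τ.isTimecone x
  refine ⟨⟨by simp [hv.1.1], smul_ne_zero hk.ne' hv.1.2⟩,
    map_mem_closure (continuous_const_smul k) hv.2 fun w hw ↦ ?_⟩
  rw [hcone] at hw ⊢
  have h1 : 0 < g.val x w w := hw.1
  refine ⟨?_, ?_⟩
  · change 0 < g.val x (k • w) (k • w)
    simp only [map_smul, _root_.smul_apply, smul_eq_mul]
    positivity
  · simpa using mul_pos hk hw.2

lemma isFutureNull_congr {x y : M} (h : x = y) {v : TangentSpace (𝓡 n) x}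
    {w : TangentSpace (𝓡 n) y} (hvw : (v : EuclideanSpace ℝ (Fin n)) = w) :
    τ.IsFutureNull v ↔ τ.IsFutureNull w := by
  subst h
  have : v = w := hvw
  rw [this]

/-- The future timecone in a chart. -/
def chartCone (e : OpenPartialHomeomorph M (EuclideanSpace ℝ (Fin n)))
    (u : EuclideanSpace ℝ (Fin n)) : Set (EuclideanSpace ℝ (Fin n)) :=
  {v | mfderiv (𝓡 n) (𝓡 n) e.symm u v ∈ τ.cone (e.symm u)}

lemma isFutureTimelike_congr {x y : M} (h : x = y) {v : TangentSpace (𝓡 n) x}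
    {w : TangentSpace (𝓡 n) y} (hvw : (v : EuclideanSpace ℝ (Fin n)) = w) :
    τ.IsFutureTimelike v ↔ τ.IsFutureTimelike w := by
  subst h
  have : v = w := hvw
  rw [this]

lemma isFutureTimelike_velocity_iff (he : e ∈ IsManifold.maximalAtlas (𝓡 n) ∞ M) {γ : ℝ → M}
    {t : ℝ} (h : IsGeodesicAt g γ t) (ht : γ t ∈ e.source) :
    τ.IsFutureTimelike (velocity n γ t) ↔ deriv (e ∘ γ) t ∈ τ.chartCone e (e (γ t)) :=
  τ.isFutureTimelike_congr (e.left_inv ht).symm (velocity_eq he h ht)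

/-- Near each point of a chart the future timecones are cut out by a fixed vector. -/
lemma exists_chartCone_eq (hn : n ≠ 0) (he : e ∈ IsManifold.maximalAtlas (𝓡 n) ∞ M)
    {u₀ : EuclideanSpace ℝ (Fin n)} (hu₀ : u₀ ∈ e.target) :
    ∃ U : EuclideanSpace ℝ (Fin n), ∀ᶠ u in 𝓝 u₀, u ∈ e.target ∧ U ∈ τ.chartCone e u ∧
      0 < g.inChart e u U U ∧
      ∀ v, v ∈ τ.chartCone e u ↔ 0 < g.inChart e u v v ∧ 0 < g.inChart e u U v := by
  obtain ⟨O, hO, hmem, X, hX, hXcone⟩ := τ.smooth (e.symm u₀)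
  -- `U` is the coordinate vector representing the orienting field at the centre. By continuity
  -- `g(X, U)` and `g(U, U)` stay positive nearby, so the constant vector `U` can replace the field.
  obtain ⟨U, hU⟩ : ∃ U : EuclideanSpace ℝ (Fin n), mfderiv (𝓡 n) (𝓡 n) e.symm u₀ U
      = X (e.symm u₀) := (LorentzMetric.mfderiv_symm_bijective he hu₀).2 (X (e.symm u₀))
  have hb : ContMDiffAt (𝓡 n) (𝓡 n) ∞ e.symm u₀ :=
    (contMDiffOn_symm_of_mem_maximalAtlas he).contMDiffAt (e.open_target.mem_nhds hu₀)
  have hcont : ContinuousAt (fun u ↦ g.val (e.symm u) (X (e.symm u))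
      (mfderiv (𝓡 n) (𝓡 n) e.symm u U)) u₀ := by
    have : ContMDiffAt (𝓡 n) ((𝓡 n).prod 𝓘(ℝ)) ∞
        (fun z ↦ Bundle.TotalSpace.mk' ℝ (E := Bundle.Trivial M ℝ) (e.symm z)
          (g.val (e.symm z) (X (e.symm z)) (mfderiv (𝓡 n) (𝓡 n) e.symm z U))) u₀ :=
      ContMDiffAt.clm_bundle_apply₂ (F₁ := EuclideanSpace ℝ (Fin n))
        (F₂ := EuclideanSpace ℝ (Fin n)) (g.smooth.contMDiffAt.comp u₀ hb)
        ((hX.contMDiffAt (hO.mem_nhds hmem)).comp u₀ hb)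
        (LorentzMetric.contMDiffAt_mfderiv_symm he hu₀ U)
    simp only [Bundle.contMDiffAt_totalSpace] at this
    exact this.2.continuousAt
  have hXX : 0 < g.val (e.symm u₀) (X (e.symm u₀)) (X (e.symm u₀)) :=
    ((τ.mem_cone_iff hn (hXcone _ hmem) _).1 (hXcone _ hmem)).1
  have hG : ContinuousAt (fun u ↦ g.inChart e u U U) u₀ :=
    (((g.contDiffAt_inChart he hu₀).clm_apply contDiffAt_const).clm_apply
      contDiffAt_const).continuousAt
  have h5 : 0 < g.val (e.symm u₀) (X (e.symm u₀)) (mfderiv (𝓡 n) (𝓡 n) e.symm u₀ U) := by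
    rwa [hU]
  have h6 : 0 < g.inChart e u₀ U U := by rwa [g.inChart_apply, hU]
  refine ⟨U, ?_⟩
  filter_upwards [e.open_target.mem_nhds hu₀, hb.continuousAt.eventually_mem (hO.mem_nhds hmem),
    hcont.eventually (lt_mem_nhds h5),
    hG.eventually (lt_mem_nhds h6)] with u h1 h2 h3 h4
  have hUcone : U ∈ τ.chartCone e u := (τ.mem_cone_iff hn (hXcone _ h2) _).2 ⟨h4, h3⟩
  exact ⟨h1, hUcone, h4, fun v ↦ τ.mem_cone_iff hn hUcone _⟩

lemma isFutureNull_velocity_chart (hn : n ≠ 0) (he : e ∈ IsManifold.maximalAtlas (𝓡 n) ∞ M)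
    {γ : ℝ → M} {t : ℝ} (h : IsGeodesicAt g γ t) (ht : γ t ∈ e.source)
    (hv : τ.IsFutureNull (velocity n γ t)) {U : EuclideanSpace ℝ (Fin n)}
    (hU : U ∈ τ.chartCone e (e (γ t))) :
    g.inChart e (e (γ t)) (deriv (e ∘ γ) t) (deriv (e ∘ γ) t) = 0 ∧
      0 < g.inChart e (e (γ t)) U (deriv (e ∘ γ) t) := by
  rw [τ.isFutureNull_congr (e.left_inv ht).symm (velocity_eq he h ht)] at hv
  exact ⟨hv.1.1, IsFutureNull.pos τ hn hU hv⟩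

/-- The set of future-pointing timelike vectors is open. -/
lemma eventually_mem_chartCone (hn : n ≠ 0) (he : e ∈ IsManifold.maximalAtlas (𝓡 n) ∞ M)
    {p : EuclideanSpace ℝ (Fin n) × EuclideanSpace ℝ (Fin n)} (hp : p.1 ∈ e.target)
    (hv : p.2 ∈ τ.chartCone e p.1) :
    ∀ᶠ z in 𝓝 p, z.1 ∈ e.target ∧ z.2 ∈ τ.chartCone e z.1 := by
  obtain ⟨U, hU⟩ := τ.exists_chartCone_eq hn he hp
  have hG : ContinuousAt (fun z : EuclideanSpace ℝ (Fin n) × EuclideanSpace ℝ (Fin n) ↦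
      g.inChart e z.1) p :=
    (g.contDiffAt_inChart he hp).continuousAt.comp continuousAt_fst
  have h1 : ContinuousAt (fun z : EuclideanSpace ℝ (Fin n) × EuclideanSpace ℝ (Fin n) ↦
      g.inChart e z.1 z.2 z.2) p := (hG.clm_apply continuousAt_snd).clm_apply continuousAt_snd
  have h2 : ContinuousAt (fun z : EuclideanSpace ℝ (Fin n) × EuclideanSpace ℝ (Fin n) ↦
      g.inChart e z.1 U z.2) p := (hG.clm_apply continuousAt_const).clm_apply continuousAt_snd
  have hv' := (hU.self_of_nhds.2.2.2 _).1 hv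
  filter_upwards [continuousAt_fst.eventually hU, h1.eventually (lt_mem_nhds hv'.1),
    h2.eventually (lt_mem_nhds hv'.2)] with z hz hz1 hz2
  exact ⟨hz.1, (hz.2.2.2 _).2 ⟨hz1, hz2⟩⟩

end TimeOrientation
end

/-! ### Timelike curves and openness of the chronological relation -/

noncomputable section

set_option linter.unusedSectionVars false

/-- A transitive relation that holds between near points of a compact interval holds between its
end points. -/
lemma rel_of_locally_rel {R : ℝ → ℝ → Prop} {a b : ℝ} (hab : a < b)
    (htrans : ∀ r s t, r ∈ Icc a b → s ∈ Icc a b → t ∈ Icc a b → R r s → R s t → R r t)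
    (hloc : ∀ t ∈ Icc a b, ∃ δ > 0, ∀ r s, r ∈ Icc a b → s ∈ Icc a b → r < s →
      |r - t| < δ → |s - t| < δ → R r s) : R a b := by
  obtain ⟨δ₀, hδ₀, h₀⟩ := hloc a ⟨le_rfl, hab.le⟩
  -- The end point `a` is left out because `R` need not be reflexive. If the supremum of `S` were
  -- less than `b`, the local hypothesis there would carry `S` past it.
  let S : Set ℝ := {t | t ∈ Ioc a b ∧ R a t}
  have hSne : min (a + δ₀ / 2) b ∈ S := by
    have h1 : a < min (a + δ₀ / 2) b := lt_min (by linarith) hab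
    have h2 : min (a + δ₀ / 2) b ≤ a + δ₀ / 2 := min_le_left _ _
    refine ⟨⟨h1, min_le_right _ _⟩, h₀ _ _ ⟨le_rfl, hab.le⟩ ⟨h1.le, min_le_right _ _⟩ h1
      (by simpa using hδ₀) ?_⟩
    rw [abs_of_pos (by linarith)]
    linarith
  have hSb : BddAbove S := ⟨b, fun t ht ↦ ht.1.2⟩
  set m := sSup S with hm
  have hma : a < m := hSne.1.1.trans_le (le_csSup hSb hSne)
  have hmb : m ≤ b := csSup_le ⟨_, hSne⟩ fun t ht ↦ ht.1.2
  obtain ⟨δ, hδ, h⟩ := hloc m ⟨hma.le, hmb⟩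
  obtain ⟨s, hs, hsm⟩ := exists_lt_of_lt_csSup ⟨_, hSne⟩ (show m - δ < sSup S by linarith)
  have hsle : s ≤ m := le_csSup hSb hs
  have hsmem : s ∈ Icc a b := Ioc_subset_Icc_self hs.1
  have hsδ : |s - m| < δ := abs_lt.2 ⟨by linarith, by linarith⟩
  have step : ∀ r ∈ Icc a b, s < r → |r - m| < δ → R a r := fun r hr hsr hrδ ↦
    htrans _ _ _ ⟨le_rfl, hab.le⟩ hsmem hr hs.2 (h s r hsmem hr hsr hsδ hrδ)
  rcases hmb.eq_or_lt with hmb' | hlt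
  · rw [← hmb']
    rcases hsle.eq_or_lt with h1 | h1
    · rw [← h1]; exact hs.2
    · exact step _ ⟨hma.le, hmb⟩ h1 (by simpa using hδ)
  · exfalso
    have h1 : m < min (m + δ / 2) b := lt_min (by linarith) hlt
    have h2 : min (m + δ / 2) b ≤ m + δ / 2 := min_le_left _ _
    have h3 : min (m + δ / 2) b ∈ S := ⟨⟨hma.trans h1, min_le_right _ _⟩,
      step _ ⟨(hma.trans h1).le, min_le_right _ _⟩ (by linarith)
        (by rw [abs_of_pos (by linarith)]; linarith)⟩
    linarith [le_csSup hSb h3]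

/-- Difference quotients converge to the strict derivative. -/
lemma HasStrictDerivAt.tendsto_two_point_slope {E : Type*} [NormedAddCommGroup E] [NormedSpace ℝ E]
    {σ : ℝ → E} {v : E} {t : ℝ} (h : HasStrictDerivAt σ v t) :
    Tendsto (fun p : ℝ × ℝ ↦ ((σ p.1, (p.2 - p.1)⁻¹ • (σ p.2 - σ p.1)), p.2 - p.1))
      (𝓝 (t, t) ⊓ 𝓟 {p | p.1 < p.2}) (𝓝 (σ t, v) ×ˢ 𝓝[>] 0) := by
  refine Tendsto.prodMk ?_ ?_
  · refine Tendsto.prodMk_nhds ?_ ?_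
    · have : ContinuousAt (fun p : ℝ × ℝ ↦ σ p.1) (t, t) :=
        ContinuousAt.comp (g := σ) (f := Prod.fst) h.hasDerivAt.continuousAt continuousAt_fst
      exact this.tendsto.mono_left inf_le_left
    · have h1 : (fun p : ℝ × ℝ ↦ σ p.2 - σ p.1 - (p.2 - p.1) • v) =o[𝓝 (t, t)]
          fun p : ℝ × ℝ ↦ p.2 - p.1 := by
        have hsw : Tendsto (Prod.swap : ℝ × ℝ → ℝ × ℝ) (𝓝 (t, t)) (𝓝 (t, t)) :=
          continuous_swap.tendsto (t, t)
        simpa [Function.comp_def] using h.hasStrictFDerivAt.isLittleO.comp_tendsto hsw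
      have h2 := (h1.mono (inf_le_left (b := 𝓟 {p : ℝ × ℝ | p.1 < p.2}))).tendsto_inv_smul_nhds_zero
      have h3 := h2.add_const v
      rw [zero_add] at h3
      refine h3.congr' ?_
      filter_upwards [mem_inf_of_right (mem_principal_self _)] with p hp
      have hp' : p.2 - p.1 ≠ 0 := (sub_pos.2 hp).ne'
      rw [smul_sub, inv_smul_smul₀ hp', sub_add_cancel]
  · refine tendsto_nhdsWithin_iff.2 ⟨?_, ?_⟩
    · have : ContinuousAt (fun p : ℝ × ℝ ↦ p.2 - p.1) (t, t) := by fun_prop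
      have h2 := this.tendsto.mono_left (inf_le_left (b := 𝓟 {p : ℝ × ℝ | p.1 < p.2}))
      simpa using h2
    · filter_upwards [mem_inf_of_right (mem_principal_self _)] with p hp
      exact sub_pos.2 hp

namespace TimeOrientation

variable {n : ℕ} {M : Type*} [TopologicalSpace M]
  [ChartedSpace (EuclideanSpace ℝ (Fin n)) M] [IsManifold (𝓡 n) ∞ M]
  {g : LorentzMetric n M} {e : OpenPartialHomeomorph M (EuclideanSpace ℝ (Fin n))}
  (τ : TimeOrientation g)

lemma IsTimelikeGeodesic.mono {γ : ℝ → M} {a b a₁ b₁ : ℝ} (h : τ.IsTimelikeGeodesic γ a b)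
    (h₁ : a₁ < b₁) (ha : a ≤ a₁) (hb : b₁ ≤ b) : τ.IsTimelikeGeodesic γ a₁ b₁ :=
  ⟨h.1.mono h₁ ha hb, fun t ht ↦ h.2 t (Icc_subset_Icc ha hb ht)⟩

lemma IsNullGeodesic.mono {γ : ℝ → M} {a b a₁ b₁ : ℝ} (h : τ.IsNullGeodesic γ a b)
    (h₁ : a₁ < b₁) (ha : a ≤ a₁) (hb : b₁ ≤ b) : τ.IsNullGeodesic γ a₁ b₁ :=
  ⟨h.1.mono h₁ ha hb, fun t ht ↦ h.2 t (Icc_subset_Icc ha hb ht)⟩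

/-- Nearby points of a chart in a nearly timelike direction are joined by a timelike geodesic. -/
lemma eventually_chron (hn : n ≠ 0) (he : e ∈ IsManifold.maximalAtlas (𝓡 n) ∞ M)
    {p : EuclideanSpace ℝ (Fin n) × EuclideanSpace ℝ (Fin n)} (hp : p.1 ∈ e.target)
    (hv : p.2 ∈ τ.chartCone e p.1) :
    ∀ᶠ z : (EuclideanSpace ℝ (Fin n) × EuclideanSpace ℝ (Fin n)) × ℝ in 𝓝 p ×ˢ 𝓝[>] 0,
      τ.Chron (e.symm z.1.1) (e.symm (z.1.1 + z.2 • z.1.2)) := by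
  let F : EuclideanSpace ℝ (Fin n) × EuclideanSpace ℝ (Fin n) → EuclideanSpace ℝ (Fin n) :=
    fun z ↦ -g.christoffel e z.1 z.2 z.2
  have hF : ∀ z : EuclideanSpace ℝ (Fin n) × EuclideanSpace ℝ (Fin n), z.1 ∈ e.target →
      ∀ᶠ y in 𝓝 z, ContDiffAt ℝ ∞ F y := fun z hz ↦ by
    filter_upwards [continuousAt_fst.eventually_mem (e.open_target.mem_nhds hz)] with y hy
    exact g.contDiffAt_christoffel hn he hy
  -- The prescribed neighbourhood consists of future timelike vectors, so the whole solution is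
  -- timelike. Its interval `(-h, 2h)` leaves the margin around `[0, h]` that a geodesic segment
  -- requires.
  filter_upwards [eventually_exists_second_order_solution (hF p hp)
    (τ.eventually_mem_chartCone hn he hp hv), tendsto_snd.eventually self_mem_nhdsWithin]
  rintro ⟨⟨u, w⟩, h⟩ ⟨x, q, hx0, hxh, hsol⟩ hh
  have hh0 : 0 < h := hh
  have hmem : ∀ t ∈ Icc 0 h, t ∈ Ioo (-h) (2 * h) := fun t ht ↦
    ⟨by linarith [ht.1], by linarith [ht.2]⟩
  have hev : ∀ t ∈ Ioo (-h) (2 * h), ∀ᶠ s in 𝓝 t, HasDerivAt x (q s) s ∧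
      HasDerivAt q (F (x s, q s)) s := fun t ht ↦ by
    filter_upwards [Ioo_mem_nhds ht.1 ht.2] with s hs
    exact ⟨(hsol s hs).1, (hsol s hs).2.1⟩
  have hgeo : ∀ t ∈ Ioo (-h) (2 * h), IsGeodesicAt g (e.symm ∘ x) t := fun t ht ↦ by
    have htt : x t ∈ e.target := (hsol t ht).2.2.1
    refine IsGeodesicAt.symm_comp hn he (contDiffAt_of_second_order (hF (x t, q t) htt)
      (hev t ht)) htt ?_
    have h1 : deriv x =ᶠ[𝓝 t] q := (hev t ht).mono fun s hs ↦ hs.1.deriv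
    rw [h1.deriv_eq, h1.self_of_nhds, (hsol t ht).2.1.deriv]
    simp [F]
  refine Relation.TransGen.single ⟨e.symm ∘ x, 0, h, ⟨⟨hh0, -h, 2 * h, by linarith, by linarith,
    (isGeodesicOn_iff isOpen_Ioo).2 hgeo⟩, fun t ht ↦ ?_⟩, by simp [hx0], by simp [hxh]⟩
  have hs := hsol t (hmem t ht)
  rw [IsFutureTimelike, velocity_symm_comp he hs.1 hs.2.2.1]
  exact hs.2.2.2

/-- Points near two near points of a curve with timelike velocity are chronologically related. -/
lemma eventually_eventually_chron (hn : n ≠ 0)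
    (he : e ∈ IsManifold.maximalAtlas (𝓡 n) ∞ M) {σ : ℝ → EuclideanSpace ℝ (Fin n)}
    {v : EuclideanSpace ℝ (Fin n)} {t : ℝ} (h : HasStrictDerivAt σ v t) (ht : σ t ∈ e.target)
    (hv : v ∈ τ.chartCone e (σ t)) :
    ∀ᶠ p : ℝ × ℝ in 𝓝 (t, t), p.1 < p.2 →
      ∀ᶠ w in 𝓝 (σ p.1, σ p.2), τ.Chron (e.symm w.1) (e.symm w.2) := by
  obtain ⟨P, hP, Q, hQ, hPQ⟩ :=
    eventually_prod_iff.1 (τ.eventually_chron hn he (p := (σ t, v)) ht hv)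
  have hA : ∀ᶠ z in 𝓝 (σ t, v) ×ˢ 𝓝[>] (0 : ℝ), ∀ᶠ y in 𝓝 z.1,
      τ.Chron (e.symm y.1) (e.symm (y.1 + z.2 • y.2)) :=
    eventually_prod_iff.2 ⟨_, hP.eventually_nhds, Q, hQ, fun h1 _ h2 ↦ h1.mono fun y hy ↦ hPQ hy h2⟩
  have h1 := h.tendsto_two_point_slope.eventually hA
  rw [eventually_inf_principal] at h1
  filter_upwards [h1] with p hp hlt
  -- With the step `p.2 - p.1` fixed, moving the end points `w` changes the base point and the slope
  -- continuously.
  have hc : ContinuousAt (fun w : EuclideanSpace ℝ (Fin n) × EuclideanSpace ℝ (Fin n) ↦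
      (w.1, (p.2 - p.1)⁻¹ • (w.2 - w.1))) (σ p.1, σ p.2) := by fun_prop
  filter_upwards [hc.eventually (hp hlt)] with w hw
  rwa [smul_inv_smul₀ (sub_pos.2 hlt).ne', add_sub_cancel] at hw

/-- The end points of a smooth timelike curve in a chart are chronologically related. -/
lemma chron_of_timelike_curve (hn : n ≠ 0) (he : e ∈ IsManifold.maximalAtlas (𝓡 n) ∞ M)
    {σ σ' : ℝ → EuclideanSpace ℝ (Fin n)} {a b : ℝ} (hab : a < b)
    (h : ∀ t ∈ Icc a b, HasStrictDerivAt σ (σ' t) t ∧ σ t ∈ e.target ∧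
      σ' t ∈ τ.chartCone e (σ t)) : τ.Chron (e.symm (σ a)) (e.symm (σ b)) := by
  refine rel_of_locally_rel (R := fun r s ↦ τ.Chron (e.symm (σ r)) (e.symm (σ s))) hab
    (fun r s t _ _ _ h1 h2 ↦ h1.trans h2) fun t ht ↦ ?_
  obtain ⟨h1, h2, h3⟩ := h t ht
  obtain ⟨δ, hδ, hball⟩ := Metric.eventually_nhds_iff_ball.1
    (τ.eventually_eventually_chron hn he h1 h2 h3)
  refine ⟨δ, hδ, fun r s _ _ hrs hr hs ↦ (hball (r, s) ?_ hrs).self_of_nhds⟩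
  rw [Metric.mem_ball, Prod.dist_eq, Real.dist_eq, Real.dist_eq]
  exact max_lt hr hs

/-- The end points of a timelike geodesic can be moved a little. -/
lemma IsTimelikeGeodesic.eventually_chron (hn : n ≠ 0) {γ : ℝ → M} {a b t : ℝ}
    (h : τ.IsTimelikeGeodesic γ a b) (ht : t ∈ Icc a b) :
    ∀ᶠ p : ℝ × ℝ in 𝓝 (t, t), p.1 < p.2 →
      ∀ᶠ w in 𝓝 (γ p.1, γ p.2), τ.Chron w.1 w.2 := by
  have hgeo := h.1.isGeodesicAt ht
  set e := chartAt (EuclideanSpace ℝ (Fin n)) (γ t)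
  have he : e ∈ IsManifold.maximalAtlas (𝓡 n) ∞ M := IsManifold.chart_mem_maximalAtlas _
  have hs : γ t ∈ e.source := mem_chart_source _ _
  have hev := τ.eventually_eventually_chron hn he (hgeo.hasStrictDerivAt_chart he hs)
    (e.map_source hs) ((τ.isFutureTimelike_velocity_iff he hgeo hs).1 (h.2 t ht))
  have hsrc : ∀ᶠ s in 𝓝 t, γ s ∈ e.source :=
    hgeo.1.continuousAt.eventually_mem (e.open_source.mem_nhds hs)
  rw [nhds_prod_eq] at hev ⊢
  filter_upwards [hev, hsrc.prod_mk hsrc] with p hp ⟨h1, h2⟩ hlt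
  have hc : ContinuousAt (fun w : M × M ↦ (e w.1, e w.2)) (γ p.1, γ p.2) :=
    (ContinuousAt.comp (g := e) (f := Prod.fst) (e.continuousAt h1) continuousAt_fst).prodMk
      (ContinuousAt.comp (g := e) (f := Prod.snd) (e.continuousAt h2) continuousAt_snd)
  filter_upwards [hc.eventually (hp hlt), continuousAt_fst.eventually_mem
    (e.open_source.mem_nhds h1), continuousAt_snd.eventually_mem
    (e.open_source.mem_nhds h2)] with w hw hw1 hw2
  rwa [e.left_inv hw1, e.left_inv hw2] at hw

/-- The chronological future of a point is open. -/
lemma Chron.eventually_right (hn : n ≠ 0) {x y : M} (h : τ.Chron x y) :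
    ∀ᶠ y' in 𝓝 y, τ.Chron x y' := by
  have key : ∀ {p q : M}, (∃ (γ : ℝ → M) (a b : ℝ), τ.IsTimelikeGeodesic γ a b ∧ γ a = p ∧
      γ b = q) → ∀ᶠ q' in 𝓝 q, τ.Chron p q' := by
    rintro p q ⟨γ, a, b, hγ, rfl, rfl⟩
    have hab := hγ.1.1
    -- Only the last geodesic is altered: it is cut at a parameter `t` so close to `b` that `γ t`
    -- precedes every point near `γ b`.
    have htend : Tendsto (fun t : ℝ ↦ (t, b)) (𝓝[<] b) (𝓝 (b, b)) :=
      (Continuous.tendsto (by fun_prop) b).mono_left nhdsWithin_le_nhds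
    obtain ⟨t, h1, h2⟩ := ((htend.eventually (hγ.eventually_chron τ hn ⟨hab.le, le_rfl⟩)).and
      (Ioo_mem_nhdsLT hab : ∀ᶠ t in 𝓝[<] b, t ∈ Ioo a b)).exists
    have h3 := (h1 h2.2).curry_nhds.self_of_nhds
    exact h3.mono fun q' hq ↦ Relation.TransGen.head
      ⟨γ, a, t, hγ.mono τ h2.1 le_rfl h2.2.le, rfl, rfl⟩ hq
  rcases Relation.TransGen.tail'_iff.1 h with ⟨w, hxw, hwy⟩
  rcases Relation.reflTransGen_iff_eq_or_transGen.1 hxw with rfl | hxw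
  · exact key hwy
  · exact (key hwy).mono fun q hq ↦ hxw.trans hq

/-- The chronological past of a point is open. -/
lemma Chron.eventually_left (hn : n ≠ 0) {x y : M} (h : τ.Chron x y) :
    ∀ᶠ x' in 𝓝 x, τ.Chron x' y := by
  have key : ∀ {p q : M}, (∃ (γ : ℝ → M) (a b : ℝ), τ.IsTimelikeGeodesic γ a b ∧ γ a = p ∧
      γ b = q) → ∀ᶠ p' in 𝓝 p, τ.Chron p' q := by
    rintro p q ⟨γ, a, b, hγ, rfl, rfl⟩
    have hab := hγ.1.1
    have htend : Tendsto (fun t : ℝ ↦ (a, t)) (𝓝[>] a) (𝓝 (a, a)) :=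
      (Continuous.tendsto (by fun_prop) a).mono_left nhdsWithin_le_nhds
    obtain ⟨t, h1, h2⟩ := ((htend.eventually (hγ.eventually_chron τ hn ⟨le_rfl, hab.le⟩)).and
      (Ioo_mem_nhdsGT hab : ∀ᶠ t in 𝓝[>] a, t ∈ Ioo a b)).exists
    have h3 : ∀ᶠ p' in 𝓝 (γ a), τ.Chron p' (γ t) :=
      (Continuous.tendsto (f := fun p' ↦ (p', γ t)) (by fun_prop) (γ a)).eventually (h1 h2.1)
    exact h3.mono fun q' hq ↦ Relation.TransGen.tail hq
      ⟨γ, t, b, hγ.mono τ h2.2 h2.1.le le_rfl, rfl, rfl⟩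
  rcases Relation.TransGen.head'_iff.1 h with ⟨w, hxw, hwy⟩
  rcases Relation.reflTransGen_iff_eq_or_transGen.1 hwy with rfl | hwy
  · exact key hxw
  · exact (key hxw).mono fun q hq ↦ hq.trans hwy

end TimeOrientation
end

/-! ### Tilting, cutting and gluing null geodesics -/

noncomputable section

set_option linter.unusedSectionVars false

lemma tendsto_bilin_apply {α E : Type*} [NormedAddCommGroup E] [NormedSpace ℝ E] {l : Filter α}
    {f : α → E →L[ℝ] E →L[ℝ] ℝ} {B : E →L[ℝ] E →L[ℝ] ℝ} {k : α → E} {k₀ : E}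
    (hf : Tendsto f l (𝓝 B)) (U : E) (hk : Tendsto k l (𝓝 k₀)) :
    Tendsto (fun x ↦ f x U (k x)) l (𝓝 (B U k₀)) :=
  ((show Continuous fun q : (E →L[ℝ] E →L[ℝ] ℝ) × E ↦ q.1 U q.2 by fun_prop).tendsto _).comp
    (hf.prodMk_nhds hk)

/-- A null vector `k` of a form `B₀` becomes timelike for a nearby form `B` after adding a small
multiple of a timelike vector. -/
lemma IsLorentzForm.tilt {E : Type*} [NormedAddCommGroup E] [NormedSpace ℝ E]
    {B B₀ : E →L[ℝ] E →L[ℝ] ℝ} (hB : IsLorentzForm B) {k U : E} {s m : ℝ} (hk : B₀ k k = 0)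
    (hs : 0 < s) (hle : ‖B - B₀‖ * ‖k‖ * ‖k‖ ≤ s * m) (hm : m < B U k) (hU : 0 < B U U) :
    0 < B (k + s • U) (k + s • U) ∧ 0 < B U (k + s • U) := by
  -- Since `B₀ k k = 0`, this gives `B k k ≥ -(s * m)`, which the cross term `2 * s * B U k > 2 * s
  -- * m` outweighs.
  have h1 := (B - B₀).le_opNorm₂ k k
  simp only [_root_.sub_apply, hk, sub_zero, Real.norm_eq_abs] at h1
  have h2 := (abs_le.1 (h1.trans hle)).1
  have hm0 : 0 ≤ m := by
    have : 0 ≤ ‖B - B₀‖ * ‖k‖ * ‖k‖ := by positivity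
    exact nonneg_of_mul_nonneg_right (this.trans hle) hs
  have h3 : s * m < s * B U k := mul_lt_mul_of_pos_left hm hs
  have h4 : 0 < s * B U U := mul_pos hs hU
  have h5 : 0 < s * (s * B U U) := mul_pos hs h4
  have h6 : 0 ≤ s * m := mul_nonneg hs.le hm0
  simp only [map_add, map_smul, _root_.add_apply, _root_.smul_apply, smul_eq_mul, hB.symm k U]
  exact ⟨by linarith, by linarith⟩

namespace TimeOrientation

variable {n : ℕ} {M : Type*} [TopologicalSpace M]
  [ChartedSpace (EuclideanSpace ℝ (Fin n)) M] [IsManifold (𝓡 n) ∞ M]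
  {g : LorentzMetric n M} {e : OpenPartialHomeomorph M (EuclideanSpace ℝ (Fin n))}
  (τ : TimeOrientation g)

/-- Short pieces of a null geodesic become timelike when they are tilted by a constant timelike
vector of a chart. -/
lemma IsNullGeodesic.exists_tilt (hn : n ≠ 0) (he : e ∈ IsManifold.maximalAtlas (𝓡 n) ∞ M)
    {γ : ℝ → M} {a b t₀ : ℝ} (h : τ.IsNullGeodesic γ a b) (ht₀ : t₀ ∈ Icc a b)
    (hs₀ : γ t₀ ∈ e.source) :
    ∃ U : EuclideanSpace ℝ (Fin n), ∃ δ > 0, ∀ t ∈ Icc a b, |t - t₀| < δ → γ t ∈ e.source ∧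
      ∀ s ∈ Ioc (0 : ℝ) 1, ∀ d : ℝ, |d| < 2 * δ → e (γ t) + (s * d) • U ∈ e.target ∧
        deriv (e ∘ γ) t + s • U ∈ τ.chartCone e (e (γ t) + (s * d) • U) := by
  have hgeo := h.1.isGeodesicAt ht₀
  have hu₀ := e.map_source hs₀
  obtain ⟨U, hU⟩ := τ.exists_chartCone_eq hn he hu₀
  have hG := g.contDiffAt_inChart he hu₀
  obtain ⟨K, N, hN, hK⟩ := (hG.of_le (by simp : (1 : WithTop ℕ∞) ≤ ∞)).exists_lipschitzOnWith
  have hc : ContinuousAt (fun t ↦ e (γ t)) t₀ := (hgeo.contDiffAt_chart he hs₀).continuousAt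
  have hc' : ContinuousAt (deriv (e ∘ γ)) t₀ := (hgeo.hasDerivAt_deriv_chart he hs₀).continuousAt
  have hm := (τ.isFutureNull_velocity_chart hn he hgeo hs₀ (h.2 t₀ ht₀)
    hU.self_of_nhds.2.1).2
  obtain ⟨m, hm0, hm1⟩ := exists_between hm
  obtain ⟨C, hC⟩ := exists_gt ‖deriv (e ∘ γ) t₀‖
  have hC0 : 0 < C := (norm_nonneg _).trans_lt hC
  have hy : ContinuousAt (fun p : ℝ × ℝ ↦ e (γ p.1) + p.2 • U) (t₀, 0) :=
    (ContinuousAt.comp (g := fun t ↦ e (γ t)) (f := Prod.fst) hc continuousAt_fst).add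
      (by fun_prop)
  have hy0 : (fun p : ℝ × ℝ ↦ e (γ p.1) + p.2 • U) (t₀, 0) = e (γ t₀) := by simp
  have hy' : Tendsto (fun p : ℝ × ℝ ↦ e (γ p.1) + p.2 • U) (𝓝 (t₀, 0)) (𝓝 (e (γ t₀))) := by
    simpa [hy0] using hy.tendsto
  have hc'' : Tendsto (fun p : ℝ × ℝ ↦ deriv (e ∘ γ) p.1) (𝓝 (t₀, 0))
      (𝓝 (deriv (e ∘ γ) t₀)) := hc'.tendsto.comp continuousAt_fst
  have hGy : Tendsto (fun p : ℝ × ℝ ↦ g.inChart e (e (γ p.1) + p.2 • U) U (deriv (e ∘ γ) p.1))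
      (𝓝 (t₀, 0)) (𝓝 (g.inChart e (e (γ t₀)) U (deriv (e ∘ γ) t₀))) :=
    tendsto_bilin_apply (hG.continuousAt.tendsto.comp hy') U hc''
  have hev : ∀ᶠ p : ℝ × ℝ in 𝓝 (t₀, 0), (γ p.1 ∈ e.source ∧ ‖deriv (e ∘ γ) p.1‖ < C) ∧
      (e (γ p.1) + p.2 • U ∈ N ∧ m < g.inChart e (e (γ p.1) + p.2 • U) U (deriv (e ∘ γ) p.1)) ∧
      (e (γ p.1) + p.2 • U ∈ e.target ∧ U ∈ τ.chartCone e (e (γ p.1) + p.2 • U) ∧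
      0 < g.inChart e (e (γ p.1) + p.2 • U) U U ∧
      ∀ v, v ∈ τ.chartCone e (e (γ p.1) + p.2 • U) ↔
        0 < g.inChart e (e (γ p.1) + p.2 • U) v v ∧
        0 < g.inChart e (e (γ p.1) + p.2 • U) U v) := by
    refine .and (.and ?_ (hc''.norm.eventually (gt_mem_nhds hC)))
      (.and (.and (hy'.eventually hN) (hGy.eventually (lt_mem_nhds hm1))) (hy'.eventually hU))
    have hfst : Tendsto Prod.fst (𝓝 (t₀, (0 : ℝ))) (𝓝 t₀) := continuousAt_fst
    exact hfst.eventually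
      (hgeo.1.continuousAt.eventually_mem (e.open_source.mem_nhds hs₀))
  obtain ⟨η, hη, hball⟩ := Metric.eventually_nhds_iff_ball.1 hev
  have hball' : ∀ t r : ℝ, |t - t₀| < η → |r| < η → (t, r) ∈ Metric.ball (t₀, (0 : ℝ)) η := by
    intro t r ht hr
    rw [Metric.mem_ball, Prod.dist_eq, Real.dist_eq, Real.dist_eq, sub_zero]
    exact max_lt ht hr
  -- The displacement `s * d` changes the metric on the tangent vector by at most `s * (2 * δ * L)`.
  -- Both this loss and the gain from tilting are linear in `s`, so one `δ` with `2 * δ * L ≤ m`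
  -- serves every `s`; `L + 1` avoids a zero denominator.
  set L : ℝ := K * ‖U‖ * C ^ 2 with hL
  have hL0 : 0 ≤ L := by positivity
  refine ⟨U, min (η / 2) (m / (2 * (L + 1))), lt_min (by positivity) (by positivity),
    fun t ht htδ ↦ ?_⟩
  have hδ1 : min (η / 2) (m / (2 * (L + 1))) ≤ η / 2 := min_le_left _ _
  have hδ2 : 2 * min (η / 2) (m / (2 * (L + 1))) * (L + 1) ≤ m := by
    have := min_le_right (η / 2) (m / (2 * (L + 1)))
    rw [le_div_iff₀ (by positivity)] at this
    linarith
  have hδ0 : 0 < min (η / 2) (m / (2 * (L + 1))) := lt_min (by positivity) (by positivity)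
  set δ := min (η / 2) (m / (2 * (L + 1)))
  obtain ⟨⟨hs, hn'⟩, ⟨hN0, -⟩, hd0⟩ := hball (t, 0) (hball' t 0 (by linarith) (by simpa using hη))
  simp only [zero_smul, add_zero] at hs hn' hN0 hd0
  refine ⟨hs, fun s hs01 d hd ↦ ?_⟩
  have hsd : |s * d| ≤ s * (2 * δ) := by
    rw [abs_mul, abs_of_pos hs01.1]
    exact mul_le_mul_of_nonneg_left hd.le hs01.1.le
  have hsdη : |s * d| < η := by
    rw [abs_mul, abs_of_pos hs01.1]
    have : s * |d| ≤ 1 * |d| := mul_le_mul_of_nonneg_right hs01.2 (abs_nonneg d)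
    linarith
  obtain ⟨-, ⟨hN1, hm2⟩, hd1, -, hUU, hiff⟩ :=
    hball (t, s * d) (hball' t (s * d) (by linarith) hsdη)
  simp only at hN1 hm2 hd1 hUU hiff
  refine ⟨hd1, (hiff _).2 ?_⟩
  have hnull := (τ.isFutureNull_velocity_chart hn he (h.1.isGeodesicAt ht) hs (h.2 t ht) hd0.2.1).1
  have hlip := hK.dist_le_mul _ hN1 _ hN0
  rw [dist_eq_norm, dist_eq_norm, add_sub_cancel_left, norm_smul, Real.norm_eq_abs] at hlip
  refine (g.isLorentzForm_inChart hn he hd1).tilt hnull hs01.1 ?_ hm2 hUU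
  have hop : ‖g.inChart e (e (γ t) + (s * d) • U) - g.inChart e (e (γ t))‖
      ≤ K * (s * (2 * δ) * ‖U‖) :=
    hlip.trans (mul_le_mul_of_nonneg_left (mul_le_mul_of_nonneg_right hsd (norm_nonneg _)) K.2)
  have h0 : 0 ≤ K * (s * (2 * δ) * ‖U‖) :=
    mul_nonneg K.2 (mul_nonneg ((abs_nonneg _).trans hsd) (norm_nonneg _))
  calc _ ≤ (K * (s * (2 * δ) * ‖U‖)) * C * C :=
        mul_le_mul (mul_le_mul hop hn'.le (norm_nonneg _) h0) hn'.le (norm_nonneg _)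
          (mul_nonneg h0 hC0.le)
    _ = s * (2 * δ * L) := by rw [hL]; ring
    _ ≤ s * m := mul_le_mul_of_nonneg_left (by linarith) hs01.1.le

/-- Chronology relations are preserved along a null geodesic. -/
lemma IsNullGeodesic.push (hn : n ≠ 0) {γ : ℝ → M} {a b : ℝ} (h : τ.IsNullGeodesic γ a b) :
    (∀ x, τ.Chron x (γ a) → τ.Chron x (γ b)) ∧ (∀ z, τ.Chron (γ b) z → τ.Chron (γ a) z) := by
  refine rel_of_locally_rel (R := fun r s ↦ (∀ x, τ.Chron x (γ r) → τ.Chron x (γ s)) ∧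
    (∀ z, τ.Chron (γ s) z → τ.Chron (γ r) z)) h.1.1
    (fun r s t _ _ _ h1 h2 ↦ ⟨fun x hx ↦ h2.1 x (h1.1 x hx), fun z hz ↦ h1.2 z (h2.2 z hz)⟩)
    fun t₀ ht₀ ↦ ?_
  have hs₀ := mem_chart_source (EuclideanSpace ℝ (Fin n)) (γ t₀)
  have he : chartAt (EuclideanSpace ℝ (Fin n)) (γ t₀) ∈ IsManifold.maximalAtlas (𝓡 n) ∞ M :=
    IsManifold.chart_mem_maximalAtlas _
  set e := chartAt (EuclideanSpace ℝ (Fin n)) (γ t₀)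
  obtain ⟨U, δ, hδ, htilt⟩ := h.exists_tilt τ hn he ht₀ hs₀
  refine ⟨δ, hδ, fun r s hr hs hrs hrδ hsδ ↦ ?_⟩
  rw [abs_lt] at hrδ hsδ
  have hmem : ∀ t ∈ Icc r s, t ∈ Icc a b ∧ |t - t₀| < δ := fun t ht ↦
    ⟨⟨hr.1.trans ht.1, ht.2.trans hs.2⟩, abs_lt.2 ⟨by linarith [ht.1], by linarith [ht.2]⟩⟩
  have hrm := hmem r ⟨le_rfl, hrs.le⟩
  have hsm := hmem s ⟨hrs.le, le_rfl⟩
  -- The parameter `t₁` marks the point left fixed by the tilt: `t₁ = s` keeps the future end for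
  -- the first claim, `t₁ = r` the past end for the second.
  have hcurve : ∀ t₁ ∈ Icc r s, ∀ ε ∈ Ioc (0 : ℝ) 1,
      τ.Chron (e.symm (e (γ r) + (ε * (r - t₁)) • U)) (e.symm (e (γ s) + (ε * (s - t₁)) • U)) := by
    intro t₁ ht₁ ε hε
    refine τ.chron_of_timelike_curve hn he (σ := fun t ↦ e (γ t) + (ε * (t - t₁)) • U)
      (σ' := fun t ↦ deriv (e ∘ γ) t + ε • U) hrs fun t ht ↦ ?_
    obtain ⟨h1, h2⟩ := hmem t ht
    obtain ⟨h3, h4⟩ := htilt t h1 h2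
    refine ⟨?_, h4 ε hε (t - t₁) (abs_lt.2 ⟨by linarith [ht.1, ht₁.2], by linarith [ht.2, ht₁.1]⟩)⟩
    have h5 : HasStrictDerivAt (fun t ↦ ε * (t - t₁)) ε t := by
      have h6 : HasStrictDerivAt (fun t ↦ t - t₁) 1 t := (hasStrictDerivAt_id t).sub_const t₁
      simpa using h6.const_mul ε
    exact ((h.1.isGeodesicAt h1).hasStrictDerivAt_chart he h3).add (h5.smul_const U)
  have htend : ∀ t ∈ Icc r s, ∀ d : ℝ, Tendsto (fun ε : ℝ ↦ e.symm (e (γ t) + (ε * d) • U)) (𝓝[>] 0)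
      (𝓝 (γ t)) := fun t ht d ↦ by
    have h3 := (htilt t (hmem t ht).1 (hmem t ht).2).1
    have h1 : ContinuousAt (fun ε : ℝ ↦ e (γ t) + (ε * d) • U) 0 := by fun_prop
    have h2 : ContinuousAt (fun ε : ℝ ↦ e.symm (e (γ t) + (ε * d) • U)) 0 := by
      refine ContinuousAt.comp (g := e.symm) (e.symm.continuousAt ?_) h1
      simpa using e.map_source h3
    have h4 := h2.tendsto.mono_left (nhdsWithin_le_nhds (s := Ioi 0))
    simpa [e.left_inv h3] using h4
  have hsmall : ∀ᶠ ε : ℝ in 𝓝[>] 0, ε ∈ Ioc (0 : ℝ) 1 := Ioc_mem_nhdsGT one_pos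
  constructor
  · intro x hx
    obtain ⟨ε, h1, h2⟩ := (((htend r ⟨le_rfl, hrs.le⟩ (r - s)).eventually
      (hx.eventually_right τ hn)).and hsmall).exists
    have h3 := hcurve s ⟨hrs.le, le_rfl⟩ ε h2
    rw [sub_self, mul_zero, zero_smul, add_zero, e.left_inv (htilt s hsm.1 hsm.2).1] at h3
    exact h1.trans h3
  · intro z hz
    obtain ⟨ε, h1, h2⟩ := (((htend s ⟨hrs.le, le_rfl⟩ (s - r)).eventually
      (hz.eventually_left τ hn)).and hsmall).exists
    have h3 := hcurve r ⟨le_rfl, hrs.le⟩ ε h2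
    rw [sub_self, mul_zero, zero_smul, add_zero, e.left_inv (htilt r hrm.1 hrm.2).1] at h3
    exact h3.trans h1

/-- A corner between null geodesics can be cut if the sum of the tangent vectors is timelike. -/
lemma IsNullGeodesic.chron_of_corner (hn : n ≠ 0) (he : e ∈ IsManifold.maximalAtlas (𝓡 n) ∞ M)
    {μ ν : ℝ → M} {a b c d : ℝ} (hμ : τ.IsNullGeodesic μ a b) (hν : τ.IsNullGeodesic ν c d)
    (hμν : μ b = ν c) (hs : μ b ∈ e.source)
    (hcone : deriv (e ∘ μ) b + deriv (e ∘ ν) c ∈ τ.chartCone e (e (μ b))) :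
    τ.Chron (μ a) (ν d) := by
  have hab := hμ.1.1
  have hcd := hν.1.1
  have hs' : ν c ∈ e.source := hμν ▸ hs
  have hgμ := hμ.1.isGeodesicAt ⟨hab.le, le_rfl⟩
  have hgν := hν.1.isGeodesicAt ⟨le_rfl, hcd.le⟩
  -- The chord across the corner. Its quotient by `h` tends to the sum of the two tangent vectors,
  -- so `μ (b - h) ≪ ν (c + h)` for small `h`; `push` then carries the relation along the remaining
  -- null pieces.
  let σ : ℝ → EuclideanSpace ℝ (Fin n) := fun h ↦ (e ∘ ν) (c + h) - (e ∘ μ) (b - h)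
  have hσ : HasDerivAt σ (deriv (e ∘ μ) b + deriv (e ∘ ν) c) 0 := by
    have h1 : HasDerivAt (e ∘ ν) (deriv (e ∘ ν) c) (c + 0) := by
      rw [add_zero]; exact (hgν.hasStrictDerivAt_chart he hs').hasDerivAt
    have h2 : HasDerivAt (e ∘ μ) (deriv (e ∘ μ) b) (b - 0) := by
      rw [sub_zero]; exact (hgμ.hasStrictDerivAt_chart he hs).hasDerivAt
    have h3 := (h1.comp_const_add c 0).sub (h2.comp_const_sub b 0)
    rw [sub_neg_eq_add, add_comm] at h3
    exact h3
  have hσ0 : σ 0 = 0 := by simp [σ, hμν]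
  have hslope : Tendsto (fun h : ℝ ↦ h⁻¹ • σ h) (𝓝[>] 0)
      (𝓝 (deriv (e ∘ μ) b + deriv (e ∘ ν) c)) := by
    have := hσ.tendsto_slope_zero_right
    simpa [hσ0] using this
  have hμt : Tendsto (fun h : ℝ ↦ μ (b - h)) (𝓝[>] 0) (𝓝 (μ b)) := by
    have : ContinuousAt (fun h : ℝ ↦ μ (b - h)) 0 :=
      ContinuousAt.comp (g := μ) (f := fun h : ℝ ↦ b - h)
        (by simpa using hgμ.1.continuousAt) (by fun_prop)
    simpa using this.tendsto.mono_left (nhdsWithin_le_nhds (s := Ioi 0))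
  have hνt : Tendsto (fun h : ℝ ↦ ν (c + h)) (𝓝[>] 0) (𝓝 (ν c)) := by
    have : ContinuousAt (fun h : ℝ ↦ ν (c + h)) 0 :=
      ContinuousAt.comp (g := ν) (f := fun h : ℝ ↦ c + h)
        (by simpa using hgν.1.continuousAt) (by fun_prop)
    simpa using this.tendsto.mono_left (nhdsWithin_le_nhds (s := Ioi 0))
  have htend : Tendsto (fun h : ℝ ↦ ((e (μ (b - h)), h⁻¹ • σ h), h)) (𝓝[>] 0)
      (𝓝 (e (μ b), deriv (e ∘ μ) b + deriv (e ∘ ν) c) ×ˢ 𝓝[>] 0) :=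
    (((e.continuousAt hs).tendsto.comp hμt).prodMk_nhds hslope).prodMk tendsto_id
  obtain ⟨h, ⟨⟨⟨h1, h2⟩, h3⟩, h4⟩, h5⟩ := ((((htend.eventually (τ.eventually_chron hn he
    (p := (e (μ b), deriv (e ∘ μ) b + deriv (e ∘ ν) c)) (e.map_source hs) hcone)).and
    (hμt.eventually (e.open_source.mem_nhds hs))).and
    (hνt.eventually (e.open_source.mem_nhds hs'))).and
    (Ioo_mem_nhdsGT (sub_pos.2 hab))).and (Ioo_mem_nhdsGT (sub_pos.2 hcd)) |>.exists
  simp only [σ] at h1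
  rw [smul_inv_smul₀ h4.1.ne', Function.comp_apply, Function.comp_apply, add_sub_cancel,
    e.left_inv h2, e.left_inv h3] at h1
  have hμ' := hμ.mono τ (show a < b - h by linarith [h4.2]) le_rfl (by linarith [h4.1])
  have hν' := hν.mono τ (show c + h < d by linarith [h5.2]) (by linarith [h5.1]) le_rfl
  exact (hμ'.push τ hn).2 _ ((hν'.push τ hn).1 _ h1)

/-- Two null geodesics with proportional tangent vectors at a common end point form a single null
geodesic. -/
lemma IsNullGeodesic.glue (hn : n ≠ 0) (he : e ∈ IsManifold.maximalAtlas (𝓡 n) ∞ M)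
    {μ ν : ℝ → M} {a b c d k : ℝ} (hμ : τ.IsNullGeodesic μ a b) (hν : τ.IsNullGeodesic ν c d)
    (hμν : μ b = ν c) (hs : μ b ∈ e.source) (hk : 0 < k)
    (hd : deriv (e ∘ ν) c = k • deriv (e ∘ μ) b) :
    ∃ ρ : ℝ → M, τ.IsNullGeodesic ρ a (b + k * (d - c)) ∧
      (∀ t ∈ Icc a b, ρ t = μ t) ∧ (∀ s ∈ Icc c d, ρ (b + k * (s - c)) = ν s) := by
  have hab := hμ.1.1
  have hcd := hν.1.1
  -- The substitution `s = k⁻¹ * t + m` inverts `t = b + k * (s - c)` and rescales the initial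
  -- velocity of `ν` to the final velocity of `μ`.
  let m : ℝ := c - k⁻¹ * b
  let ν' : ℝ → M := fun t ↦ ν (k⁻¹ * t + m)
  have hm : ∀ s, k⁻¹ * (b + k * (s - c)) + m = s := fun s ↦ by
    simp only [m]; field_simp; ring
  have hm' : ∀ t, t = b + k * ((k⁻¹ * t + m) - c) := fun t ↦ by
    simp only [m]; field_simp; ring
  have hmb : k⁻¹ * b + m = c := by simp [m]
  have hν'geo : ∀ t, IsGeodesicAt g ν (k⁻¹ * t + m) → IsGeodesicAt g ν' t := fun t h ↦ h.comp_affine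
  -- Both segments extend as geodesics beyond the joint, so uniqueness makes them agree on both
  -- sides of it. This is why the piecewise path `ρ` is smooth at `b`.
  have hev : μ =ᶠ[𝓝 b] ν' := by
    have hcont : ContinuousAt (fun t : ℝ ↦ k⁻¹ * t + m) b := by fun_prop
    have h1 : ∀ᶠ t in 𝓝 b, IsGeodesicAt g ν' t := by
      have h2 : ∀ᶠ s in 𝓝 (k⁻¹ * b + m), IsGeodesicAt g ν s := by
        rw [hmb]; exact hν.1.eventually_isGeodesicAt ⟨le_rfl, hcd.le⟩
      exact (hcont.eventually h2).mono fun t ht ↦ hν'geo t ht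
    refine IsGeodesicAt.eventuallyEq hn he (hμ.1.eventually_isGeodesicAt ⟨hab.le, le_rfl⟩) h1 hs
      (by simp only [ν', hmb, hμν]) ?_
    have h2 : HasDerivAt (e ∘ ν) (deriv (e ∘ ν) c) (k⁻¹ * b + m) := by
      rw [hmb]
      exact ((hν.1.isGeodesicAt ⟨le_rfl, hcd.le⟩).hasStrictDerivAt_chart he (hμν ▸ hs)).hasDerivAt
    have h3 : HasDerivAt (fun t : ℝ ↦ k⁻¹ * t + m) k⁻¹ b := by
      simpa using ((hasDerivAt_id b).const_mul k⁻¹).add_const m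
    have h4 := (h2.scomp b h3).deriv
    rw [hd, inv_smul_smul₀ hk.ne'] at h4
    exact h4.symm
  let ρ : ℝ → M := fun t ↦ if t ≤ b then μ t else ν' t
  have hρμ : ∀ t ≤ b, ρ =ᶠ[𝓝 t] μ := by
    intro t ht
    rcases ht.eq_or_lt with rfl | ht
    · filter_upwards [hev] with s hs
      by_cases hsb : s ≤ t <;> simp [ρ, hsb, hs]
    · filter_upwards [gt_mem_nhds ht] with s hs
      simp [ρ, hs.le]
  have hρν : ∀ t, b < t → ρ =ᶠ[𝓝 t] ν' := by
    intro t ht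
    filter_upwards [lt_mem_nhds ht] with s hs
    simp [ρ, hs.not_ge]
  obtain ⟨-, a₁, b₁, ha₁, hb₁, hμo⟩ := id hμ.1
  obtain ⟨-, c₁, d₁, hc₁, hd₁, hνo⟩ := id hν.1
  have hmono : ∀ t s, t < b + k * (s - c) ↔ k⁻¹ * t + m < s := fun t s ↦ by
    conv_lhs => rw [hm' t]
    rw [add_lt_add_iff_left, mul_lt_mul_iff_right₀ hk, sub_lt_sub_iff_right]
  refine ⟨ρ, ⟨⟨?_, a₁, b + k * (d₁ - c), ha₁, ?_, (isGeodesicOn_iff isOpen_Ioo).2 ?_⟩, ?_⟩, ?_, ?_⟩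
  · have := mul_pos hk (sub_pos.2 hcd)
    linarith
  · have := mul_lt_mul_of_pos_left (sub_lt_sub_right hd₁ c) hk
    linarith
  · intro t ht
    rcases le_or_gt t b with htb | htb
    · exact ((isGeodesicOn_iff isOpen_Ioo).1 hμo t ⟨ht.1, htb.trans_lt hb₁⟩).congr (hρμ t htb)
    · refine (hν'geo t ((isGeodesicOn_iff isOpen_Ioo).1 hνo _ ⟨?_, (hmono t d₁).1 ht.2⟩)).congr
        (hρν t htb)
      have : k⁻¹ * b < k⁻¹ * t := mul_lt_mul_of_pos_left htb (inv_pos.2 hk)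
      linarith
  · intro t ht
    rcases le_or_gt t b with htb | htb
    · exact (τ.isFutureNull_congr (hρμ t htb).self_of_nhds (velocity_congr (hρμ t htb))).2
        (hμ.2 t ⟨ht.1, htb⟩)
    · have hmem : k⁻¹ * t + m ∈ Icc c d := by
        constructor
        · have : k⁻¹ * b < k⁻¹ * t := mul_lt_mul_of_pos_left htb (inv_pos.2 hk)
          linarith
        · by_contra! hcon
          have h1 := hm' t
          have := mul_lt_mul_of_pos_left (sub_lt_sub_right hcon c) hk
          linarith [ht.2]
      have hvel := velocity_comp_affine (n := n) (γ := ν) (k := k⁻¹) (m := m) (t := t)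
        ((hν.1.isGeodesicAt hmem).1.mdifferentiableAt (by simp))
      refine (τ.isFutureNull_congr (hρν t htb).self_of_nhds
        ((velocity_congr (hρν t htb)).trans hvel)).2 ?_
      exact IsFutureNull.smul τ (hν.2 _ hmem) (inv_pos.2 hk)
  · intro t ht
    simp [ρ, ht.2]
  · intro s hs
    rcases hs.1.eq_or_lt with rfl | hlt
    · simp [ρ, hμν]
    · have : ¬ b + k * (s - c) ≤ b := by
        have := mul_pos hk (sub_pos.2 hlt)
        linarith
      simp only [ρ, this, if_false, ν', hm s]

/-- Two consecutive null geodesics either form a single null geodesic, or their extreme points are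
chronologically related. -/
lemma IsNullGeodesic.chron_or_glue (hn : n ≠ 0) {μ ν : ℝ → M} {a b c d : ℝ}
    (hμ : τ.IsNullGeodesic μ a b) (hν : τ.IsNullGeodesic ν c d) (hμν : μ b = ν c) :
    τ.Chron (μ a) (ν d) ∨ ∃ (ρ : ℝ → M) (k : ℝ), 0 < k ∧
      τ.IsNullGeodesic ρ a (b + k * (d - c)) ∧
      (∀ t ∈ Icc a b, ρ t = μ t) ∧ (∀ s ∈ Icc c d, ρ (b + k * (s - c)) = ν s) := by
  have hs := mem_chart_source (EuclideanSpace ℝ (Fin n)) (μ b)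
  have he : chartAt (EuclideanSpace ℝ (Fin n)) (μ b) ∈ IsManifold.maximalAtlas (𝓡 n) ∞ M :=
    IsManifold.chart_mem_maximalAtlas _
  set e := chartAt (EuclideanSpace ℝ (Fin n)) (μ b)
  have hb : b ∈ Icc a b := ⟨hμ.1.1.le, le_rfl⟩
  have hc : c ∈ Icc c d := ⟨le_rfl, hν.1.1.le⟩
  obtain ⟨U, hU⟩ := τ.exists_chartCone_eq hn he (e.map_source hs)
  obtain ⟨htar, hUcone, hUU, hiff⟩ := hU.self_of_nhds
  have hk := τ.isFutureNull_velocity_chart hn he (hμ.1.isGeodesicAt hb) hs (hμ.2 b hb) hUcone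
  have hl := τ.isFutureNull_velocity_chart hn he (hν.1.isGeodesicAt hc) (hμν ▸ hs) (hν.2 c hc)
    (hμν ▸ hUcone)
  rw [← hμν] at hl
  rcases (g.isLorentzForm_inChart hn he htar).add_timelike_or_proportional hUU hk.1 hl.1 hk.2 hl.2
    with h | ⟨k, hk0, h⟩
  · left
    refine hμ.chron_of_corner τ hn he hν hμν hs ((hiff _).2 ⟨h, ?_⟩)
    rw [map_add]
    exact add_pos hk.2 hl.2
  · right
    obtain ⟨ρ, hρ⟩ := hμ.glue τ hn he hν hμν hs hk0 h
    exact ⟨ρ, k, hk0, hρ⟩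

end TimeOrientation

/-- A degenerate geodesic is constant. -/
lemma IsDegenerateGeodesic.eq {n : ℕ} {M : Type*} [TopologicalSpace M]
    [ChartedSpace (EuclideanSpace ℝ (Fin n)) M] [IsManifold (𝓡 n) ∞ M] {g : LorentzMetric n M}
    {γ : ℝ → M} {a b : ℝ} (h : IsDegenerateGeodesic g γ a b) : γ a = γ b := by
  refine rel_of_locally_rel (R := fun r s ↦ γ r = γ s) h.1.1
    (fun r s t _ _ _ h1 h2 ↦ h1.trans h2) fun t₀ ht₀ ↦ ?_
  have hs₀ := mem_chart_source (EuclideanSpace ℝ (Fin n)) (γ t₀)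
  have he : chartAt (EuclideanSpace ℝ (Fin n)) (γ t₀) ∈ IsManifold.maximalAtlas (𝓡 n) ∞ M :=
    IsManifold.chart_mem_maximalAtlas _
  set e := chartAt (EuclideanSpace ℝ (Fin n)) (γ t₀)
  obtain ⟨δ, hδ, hsrc⟩ := Metric.eventually_nhds_iff_ball.1
    ((h.1.isGeodesicAt ht₀).1.continuousAt.eventually_mem (e.open_source.mem_nhds hs₀))
  refine ⟨δ, hδ, fun r s hr hs hrs hrδ hsδ ↦ ?_⟩
  have hmem : ∀ t ∈ Icc r s, γ t ∈ e.source := fun t ht ↦ hsrc t (by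
    rw [abs_lt] at hrδ hsδ
    rw [Metric.mem_ball, Real.dist_eq, abs_lt]
    exact ⟨by linarith [ht.1], by linarith [ht.2]⟩)
  have hder : ∀ t ∈ Icc r s, HasDerivAt (e ∘ γ) 0 t := fun t ht ↦ by
    have htab : t ∈ Icc a b := ⟨hr.1.trans ht.1, ht.2.trans hs.2⟩
    have hgeo := h.1.isGeodesicAt htab
    have h1 := (hgeo.hasStrictDerivAt_chart he (hmem t ht)).hasDerivAt
    have h2 : mfderiv (𝓡 n) (𝓡 n) e.symm (e (γ t)) (deriv (e ∘ γ) t) = 0 :=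
      (velocity_eq he hgeo (hmem t ht)).symm.trans (h.2 t htab)
    have h3 : deriv (e ∘ γ) t = 0 :=
      (LorentzMetric.mfderiv_symm_bijective he (e.map_source (hmem t ht))).1
        (h2.trans (ContinuousLinearMap.map_zero _).symm)
    rwa [h3] at h1
  have hconst := constant_of_has_deriv_right_zero (f := e ∘ γ) (a := r) (b := s)
    (fun t ht ↦ (hder t ht).continuousAt.continuousWithinAt)
    (fun t ht ↦ (hder t (Ico_subset_Icc_self ht)).hasDerivWithinAt) s ⟨hrs.le, le_rfl⟩
  exact e.injOn (hmem r ⟨le_rfl, hrs.le⟩) (hmem s ⟨hrs.le, le_rfl⟩) hconst.symm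

/-! ### Trips and causal trips -/

namespace TimeOrientation

variable {n : ℕ} {M : Type*} [TopologicalSpace M]
  [ChartedSpace (EuclideanSpace ℝ (Fin n)) M] [IsManifold (𝓡 n) ∞ M]
  {g : LorentzMetric n M} (τ : TimeOrientation g)

/-- A causal geodesic is timelike, null, or has equal end points. -/
lemma IsCausalGeodesic.push (hn : n ≠ 0) {γ : ℝ → M} {a b : ℝ} (h : τ.IsCausalGeodesic γ a b) :
    (∀ x, τ.Chron x (γ a) → τ.Chron x (γ b)) ∧ (∀ z, τ.Chron (γ b) z → τ.Chron (γ a) z) := by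
  rcases h with h | h | h
  · exact ⟨fun x hx ↦ hx.tail ⟨γ, a, b, h, rfl, rfl⟩,
      fun z hz ↦ Relation.TransGen.head ⟨γ, a, b, h, rfl, rfl⟩ hz⟩
  · exact IsNullGeodesic.push τ hn h
  · rw [h.eq]
    exact ⟨fun _ ↦ id, fun _ ↦ id⟩

lemma Chron.trans_causal (hn : n ≠ 0) {x y z : M} (hxy : τ.Chron x y) (hyz : τ.Causal y z) :
    τ.Chron x z := by
  induction hyz with
  | single h =>
    obtain ⟨γ, a, b, hγ, rfl, rfl⟩ := h
    exact (hγ.push τ hn).1 _ hxy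
  | tail _ h ih =>
    obtain ⟨γ, a, b, hγ, rfl, rfl⟩ := h
    exact (hγ.push τ hn).1 _ ih

lemma Causal.trans_chron (hn : n ≠ 0) {x y z : M} (hxy : τ.Causal x y) (hyz : τ.Chron y z) :
    τ.Chron x z := by
  induction hxy with
  | single h =>
    obtain ⟨γ, a, b, hγ, rfl, rfl⟩ := h
    exact (hγ.push τ hn).2 _ hyz
  | tail _ h ih =>
    obtain ⟨γ, a, b, hγ, rfl, rfl⟩ := h
    exact ih ((hγ.push τ hn).2 _ hyz)

/-- The trichotomy is preserved when a geodesic is appended: a chronological relation persists by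
`Chron.trans_causal`, and a null geodesic followed by another is either glued to it or has its
corner cut. Keeping the case `x = y` accounts for degenerate pieces. -/
lemma Causal.chron_or_eq_or_null (hn : n ≠ 0) {x y : M} (h : τ.Causal x y) :
    τ.Chron x y ∨ x = y ∨ ∃ (μ : ℝ → M) (a b : ℝ), τ.IsNullGeodesic μ a b ∧ μ a = x ∧ μ b = y := by
  have step : ∀ {p q : M}, (∃ (γ : ℝ → M) (a b : ℝ), τ.IsCausalGeodesic γ a b ∧ γ a = p ∧
      γ b = q) → τ.Chron p q ∨ p = q ∨
        ∃ (μ : ℝ → M) (a b : ℝ), τ.IsNullGeodesic μ a b ∧ μ a = p ∧ μ b = q := by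
    rintro p q ⟨γ, a, b, h | h | h, rfl, rfl⟩
    · exact .inl (.single ⟨γ, a, b, h, rfl, rfl⟩)
    · exact .inr (.inr ⟨γ, a, b, h, rfl, rfl⟩)
    · exact .inr (.inl h.eq)
  induction h with
  | single h => exact step h
  | tail hxp hpq ih =>
    rcases ih with h | rfl | ⟨μ, a, b, hμ, rfl, rfl⟩
    · exact .inl (Chron.trans_causal τ hn h (.single hpq))
    · exact step hpq
    · rcases step hpq with h | rfl | ⟨ν, c, d, hν, hνc, rfl⟩
      · exact .inl (Causal.trans_chron τ hn hxp h)
      · exact .inr (.inr ⟨μ, a, b, hμ, rfl, rfl⟩)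
      · rcases hμ.chron_or_glue τ hn hν hνc.symm with h | ⟨ρ, k, hk, hρ, h1, h2⟩
        · exact .inl h
        · exact .inr (.inr ⟨ρ, a, b + k * (d - c), hρ, h1 a ⟨le_rfl, hμ.1.1.le⟩,
            h2 d ⟨hν.1.1.le, le_rfl⟩⟩)

end TimeOrientation
end

theorem mainTheorem2 {n : ℕ} (hn : 2 ≤ n) {M : Type*} [TopologicalSpace M]
    [ChartedSpace (EuclideanSpace ℝ (Fin n)) M] [IsManifold (𝓡 n) ∞ M]
    [T2Space M] [ConnectedSpace M] (g : LorentzMetric n M) (τ : TimeOrientation g) (x y z : M) :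
    ((τ.Chron x y → τ.Causal y z → τ.Chron x z) ∧
      (τ.Causal x y → τ.Chron y z → τ.Chron x z)) ∧
    (∀ (μ ν : ℝ → M) (a b c d : ℝ),
      τ.IsNullGeodesic μ a b → μ a = x → μ b = y →
      τ.IsNullGeodesic ν c d → ν c = y → ν d = z →
      τ.Chron x z ∨
        ∃ (ρ : ℝ → M) (k : ℝ), 0 < k ∧ τ.IsNullGeodesic ρ a (b + k * (d - c)) ∧
          (∀ t ∈ Icc a b, ρ t = μ t) ∧ (∀ s ∈ Icc c d, ρ (b + k * (s - c)) = ν s)) ∧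
    (τ.Causal x y → ¬ τ.Chron x y → x ≠ y →
      ∃ (μ : ℝ → M) (a b : ℝ), τ.IsNullGeodesic μ a b ∧ μ a = x ∧ μ b = y) := by
  have hn' : n ≠ 0 := by omega
  refine ⟨⟨TimeOrientation.Chron.trans_causal τ hn', TimeOrientation.Causal.trans_chron τ hn'⟩,
    ?_, fun h h1 h2 ↦ ?_⟩
  · rintro μ ν a b c d hμ rfl hμb hν hνc rfl
    exact hμ.chron_or_glue τ hn' hν (hμb.trans hνc.symm)
  · rcases TimeOrientation.Causal.chron_or_eq_or_null τ hn' h with h3 | h3 | h3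
    · exact absurd h3 h1
    · exact absurd h3 h2
    · exact h3
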